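/- Let $\xi,\xi_1,\xi_2,\dots$ be independent real random variables with common distribution $F$, $\overline F(x)=\mathbf P(\xi>x)$, $\xi^-=\max\{-\xi,0\}$. Put $S_0=0$, $S_n=\xi_1+\dots+\xi_n$, let $\tau=\inf\{n\ge 1: S_n<0\}$ and $M_\tau=\max_{0\le i\le\tau}S_i$, and let $m(x)=\mathbf E\min\{\xi^-,x\}$ for $x\ge 0$. For functions $a,b$, write $a(x)\sim b(x)$ if $a(x)/b(x)\to 1$ as $x\to\infty$ (in particular $b(x)\neq 0$ for all large $x$). A probability distribution $G$ on $[0,\infty)$ is said to belong to the class $\mathcal S_F$ if $$\int_{[0,x]}\overline F(x-u)\,G(du)\sim\overline F(x).$$ Suppose that $\mathbf E\xi^-=\infty$ and that $$K:=\int_{(0,\infty)}\frac{x}{m(x)}\,F(dx)<\infty .$$ Let $G_1$ be the probability distribution on $[0,\infty)$ with tail $$\overline G_1(x)=\frac1K\int_{(x,\infty)}\frac{t-x}{m(t-x)}\,F(dt),\qquad x\ge 0.$$ If $G_1\in\mathcal S_F$, then $\mathbf E\tau<\infty$ and $$\mathbf P(M_\tau>x)\sim\mathbf E\tau\,\overline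 F(x)\qquad\text{as }x\to\infty .$$ The same holds, with the corresponding $\tau$, $\mathbf E\tau$ and $M_\tau$, if $\tau$ is instead defined as $\inf\{n\ge1: S_n\le 0\}$. -/

import Mathlib

open MeasureTheory ProbabilityTheory Filter Topology
open scoped ENNReal

/-- The (possibly infinite) expectation `E ξ⁻`, where `ξ` has law `F` and
`ξ⁻ = max (-ξ) 0`. -/
noncomputable def negPartMean (F : Measure ℝ) : ℝ≥0∞ :=
  ∫⁻ y, ENNReal.ofReal (max (-y) 0) ∂F

/-- The negative truncated mean function `m(x) = E min(ξ⁻, x)`, `x ≥ 0`, where `ξ` has law `F`. -/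
noncomputable def truncNegMean (F : Measure ℝ) (x : ℝ) : ℝ≥0∞ :=
  ∫⁻ y, ENNReal.ofReal (min (max (-y) 0) x) ∂F

/-- The (unnormalised) tail `∫_{(x,∞)} (t - x) / m(t - x) F(dt)`. The interval is open: at `t = x`
the integrand is `0 / 0`, and only the open interval gives a right-continuous function of `x`. -/
noncomputable def weightedTail (F : Measure ℝ) (x : ℝ) : ℝ≥0∞ :=
  ∫⁻ t in Set.Ioi x, ENNReal.ofReal (t - x) / truncNegMean F (t - x) ∂F

/-- The constant `K = ∫_{(0,∞)} x / m(x) F(dx)`. -/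
noncomputable def tailConst (F : Measure ℝ) : ℝ≥0∞ :=
  ∫⁻ t in Set.Ioi (0 : ℝ), ENNReal.ofReal t / truncNegMean F t ∂F

/-- `G` is the probability distribution on `[0, ∞)` with the tail
`G((x, ∞)) = K⁻¹ ∫_x^∞ (t - x) / m(t - x) F(dt)` for all `x ≥ 0`. (This determines `G`.) -/
def IsWeightedTailLaw (F G : Measure ℝ) : Prop :=
  IsProbabilityMeasure G ∧ G (Set.Iio 0) = 0 ∧
    ∀ x : ℝ, 0 ≤ x → G (Set.Ioi x) = weightedTail F x / tailConst F

/-- The class `𝓢_F`: `G` is a probability distribution on `[0, ∞)` and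
`∫_{[0,x]} F((x - u, ∞)) G(du) ∼ F((x, ∞))` as `x → ∞`, that is, the ratio tends to `1`.
(In particular `F((x, ∞)) > 0` for all `x`, since otherwise the ratio is eventually `0 / 0 = 0`.) -/
def InClassS (F G : Measure ℝ) : Prop :=
  IsProbabilityMeasure G ∧ G (Set.Iio 0) = 0 ∧
    Tendsto (fun x : ℝ =>
      (∫ u in Set.Icc 0 x, F.real (Set.Ioi (x - u)) ∂G) / F.real (Set.Ioi x)) atTop (𝓝 1)

/-- The random walk `S₀ = 0`, `Sₙ = ξ₁ + ⋯ + ξₙ`; the `n`-th step `ξₙ` is `ξ (n - 1)` here. -/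
def walk {Ω : Type*} (ξ : ℕ → Ω → ℝ) (n : ℕ) (ω : Ω) : ℝ :=
  ∑ i ∈ Finset.range n, ξ i ω

/-- `τ = inf {n ≥ 1 : Sₙ ∈ A}`, with value `∞` if there is no such `n`. -/
noncomputable def exitTime {Ω : Type*} (ξ : ℕ → Ω → ℝ) (A : Set ℝ) (ω : Ω) : ℕ∞ :=
  hittingAfter (walk ξ) A 1 ω

/-- `M_τ = max_{0 ≤ i ≤ τ} Sᵢ` (a supremum in the extended reals, also meaningful where `τ = ∞`). -/
noncomputable def maxUpToExit {Ω : Type*} (ξ : ℕ → Ω → ℝ) (A : Set ℝ) (ω : Ω) : EReal :=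
  ⨆ (i : ℕ) (_ : (i : ℕ∞) ≤ exitTime ξ A ω), (walk ξ i ω : EReal)

/-- The expectation `E τ`. -/
noncomputable def meanExitTime {Ω : Type*} [MeasurableSpace Ω] (P : Measure Ω)
    (ξ : ℕ → Ω → ℝ) (A : Set ℝ) : ℝ≥0∞ :=
  ∫⁻ ω, (exitTime ξ A ω : ℝ≥0∞) ∂P

/-!
The proof treats the walk killed outside `B = Aᶜ` by potential theory, without ladder heights. Let
`m` be the truncated mean and let `N v` be the mean lifetime of the killed walk started at `v`
(`meanLifetime`), so that `N 0 = E τ`.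

*The mean lifetime.* The function `y / m y` is comparable with a concave function `W`
(`lyapunovFun`). Far from the origin the upward jumps change the mean of `W` by `o(1)`, because
`E ξ⁺ / m(ξ⁺) < ∞` and `m → ∞`, while the downward jumps decrease it by a constant
(`exists_drift`). Using `W (R + ·)` with `R` large as a supersolution gives
`N z ≤ C (z + 1) / m (z + 1)` (`meanLifetime_le`), hence `E τ < ∞`.

*Big jumps.* The tail of `G₁` at `u` is the mean of `(ξ - u)⁺ / m (ξ - u)`, up to the factor `K`. So
`G₁ ∈ 𝓢_F` says that two jumps, each at most `y` and with sum at least `y`, contribute only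
`o(P(ξ > y))` even when weighted by `N` at the overshoot of the sum over `y`
(`eventually_doubleJump_le`); it also makes `F` long-tailed (`eventually_measure_Ioc_le`).

*Upper bound.* With `N` set to `0` below `0`, let `g v` be the mean of `N (v - (x - ξ)⁺)`
(`exceedPot`). Since `N` decreases by `1` per step, `g` decreases by `P(ξ > x - v)` per step, except
that the walk may jump from below `(x - ξ)⁺` to above it, which takes two big jumps
(`exceedPot_drift`). Hence `g` is, up to a factor `1 + o(1)`, a supersolution of the equation for
the probability of exceeding `x`, as long as the walk is far below `x`. Near `x` a bound with a
non-sharp constant (`exceedProb_le_mul`) is enough, because the lower bound leaves only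
`o(P(ξ > x))` for the paths that come near `x` without exceeding it at once (`exceedProb_split`). Finally
`g 0 = N 0 * P(ξ ≥ x)`.

*Lower bound.* From any nonnegative height the next step exceeds `x` with probability at least
`P(ξ > x)`, and the expected number of steps before `τ` is `N 0` (`eventually_mul_le_killedPot`).
-/

/-! ### The truncated mean -/

section TruncatedMean

variable {F : Measure ℝ}

lemma truncNegMean_mono : Monotone (truncNegMean F) := fun x y h => by
  unfold truncNegMean
  gcongr

lemma truncNegMean_le [IsProbabilityMeasure F] (x : ℝ) : truncNegMean F x ≤ ENNReal.ofReal x := by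
  unfold truncNegMean
  calc _ ≤ ∫⁻ _, ENNReal.ofReal x ∂F := by
        gcongr; exact min_le_right _ _
    _ = _ := by simp

lemma truncNegMean_ne_top [IsProbabilityMeasure F] (x : ℝ) : truncNegMean F x ≠ ∞ :=
  ne_top_of_le_ne_top ENNReal.ofReal_ne_top (truncNegMean_le x)

lemma truncNegMean_pos (hneg : negPartMean F = ∞) {x : ℝ} (hx : 0 < x) :
    0 < truncNegMean F x := by
  rw [pos_iff_ne_zero]
  intro h
  unfold truncNegMean at h
  rw [lintegral_eq_zero_iff (by fun_prop)] at h
  have : negPartMean F = 0 := by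
    unfold negPartMean
    rw [lintegral_eq_zero_iff (by fun_prop)]
    filter_upwards [h] with y hy
    simp only [Pi.zero_apply, ENNReal.ofReal_eq_zero] at hy ⊢
    rcases min_le_iff.1 hy with h | h
    · exact h
    · linarith
  simp [this] at hneg

lemma tendsto_truncNegMean (hneg : negPartMean F = ∞) :
    Tendsto (truncNegMean F) atTop (𝓝 ∞) := by
  have h1 : Tendsto (fun n : ℕ => truncNegMean F n) atTop (𝓝 ∞) := by
    rw [← hneg]
    refine lintegral_tendsto_of_tendsto_of_monotone (fun n => by fun_prop) ?_ ?_
    · refine Eventually.of_forall fun y a b h => ENNReal.ofReal_le_ofReal ?_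
      exact min_le_min_left _ (Nat.cast_le.2 h)
    · refine Eventually.of_forall fun y => ?_
      refine tendsto_const_nhds.congr' ?_
      filter_upwards [eventually_ge_atTop ⌈max (-y) 0⌉₊] with n hn
      rw [min_eq_left (Nat.ceil_le.1 hn)]
  have h2 := tendsto_atTop_iSup (truncNegMean_mono (F := F))
  have h3 := tendsto_nhds_unique h1 (h2.comp tendsto_natCast_atTop_atTop)
  rwa [h3]

lemma truncNegMean_scale {a b : ℝ} (ha : 0 ≤ a) (hab : a ≤ b) :
    ENNReal.ofReal a * truncNegMean F b ≤ ENNReal.ofReal b * truncNegMean F a := by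
  unfold truncNegMean
  rw [← lintegral_const_mul _ (by fun_prop), ← lintegral_const_mul _ (by fun_prop)]
  refine lintegral_mono fun y => ?_
  rw [← ENNReal.ofReal_mul ha, ← ENNReal.ofReal_mul (ha.trans hab)]
  refine ENNReal.ofReal_le_ofReal ?_
  have hs : 0 ≤ max (-y) 0 := le_max_right _ _
  generalize max (-y) 0 = s at hs
  rcases le_total s a with h | h
  · rw [min_eq_left h, min_eq_left (h.trans hab)]
    nlinarith
  · rw [min_eq_right h]
    nlinarith [min_le_right s b]

lemma truncNegMean_le_add {y c : ℝ} (hy : 0 ≤ y) (hc : 0 ≤ c) :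
    truncNegMean F (y + c) ≤ truncNegMean F y + ENNReal.ofReal c * F (Set.Iio (-y)) := by
  unfold truncNegMean
  rw [← lintegral_indicator_const measurableSet_Iio, ← lintegral_add_left (by fun_prop)]
  refine lintegral_mono fun z => ?_
  by_cases hz : z < -y
  · rw [Set.indicator_of_mem (Set.mem_Iio.2 hz), ← ENNReal.ofReal_add (le_min (by simp) hy) hc]
    refine ENNReal.ofReal_le_ofReal ?_
    rw [min_eq_right (a := max (-z) 0) (b := y) (le_max_of_le_left (by linarith))]
    exact min_le_right _ _
  · rw [Set.indicator_of_notMem (by simpa using hz), add_zero]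
    have : max (-z) 0 ≤ y := max_le (by linarith [not_lt.1 hz]) hy
    rw [min_eq_left this]
    exact ENNReal.ofReal_le_ofReal (min_le_left _ _)

lemma tendsto_lintegral_increment (hneg : negPartMean F = ∞) (hK : tailConst F < ∞) :
    Tendsto (fun y : ℝ => ∫⁻ t in Set.Ioi (0 : ℝ),
      min (2 * (ENNReal.ofReal t / truncNegMean F y))
        (2 * (ENNReal.ofReal t / truncNegMean F t)) ∂F)
      atTop (𝓝 0) := by
  have hm : Measurable (truncNegMean F) := truncNegMean_mono.measurable
  rw [← lintegral_zero (μ := F.restrict (Set.Ioi 0))]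
  refine tendsto_lintegral_filter_of_dominated_convergence
    (fun t => 2 * (ENNReal.ofReal t / truncNegMean F t)) ?_ ?_ ?_ ?_
  · exact Eventually.of_forall fun y => by fun_prop
  · exact Eventually.of_forall fun y => Eventually.of_forall fun t => min_le_right _ _
  · rw [lintegral_const_mul _ (by fun_prop)]
    exact ENNReal.mul_ne_top (by simp) hK.ne
  · refine Eventually.of_forall fun t => ?_
    have h1 : Tendsto (fun y : ℝ => 2 * (ENNReal.ofReal t / truncNegMean F y)) atTop (𝓝 0) := by
      have := ENNReal.Tendsto.const_div (a := ENNReal.ofReal t) (tendsto_truncNegMean hneg)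
        (Or.inr ENNReal.ofReal_ne_top)
      have := ENNReal.Tendsto.const_mul (a := 2) this (Or.inr (by simp))
      simpa using this
    exact tendsto_of_tendsto_of_tendsto_of_le_of_le tendsto_const_nhds h1 (fun _ => zero_le)
      (fun y => min_le_left _ _)

end TruncatedMean

/-! ### A concave function comparable with `y / m y` -/

section Lyapunov

/-- The lower envelope of the affine functions `y ↦ (a + y) / m a`, `a > 0`. For `m` positive and
nondecreasing with `m a / a` nonincreasing it is concave and lies between `y / m y` and
`2 * y / m y`. -/
noncomputable def lyapunovFun (m : ℝ → ℝ) (y : ℝ) : ℝ :=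
  ⨅ a : Set.Ioi (0 : ℝ), ((a : ℝ) + y) / m a

variable {m : ℝ → ℝ}

lemma lyapunovFun_le (hpos : ∀ a, 0 < a → 0 < m a) {y a : ℝ} (hy : 0 ≤ y) (ha : 0 < a) :
    lyapunovFun m y ≤ (a + y) / m a := by
  refine ciInf_le (f := fun a : Set.Ioi (0 : ℝ) => ((a : ℝ) + y) / m a) ⟨0, ?_⟩ ⟨a, ha⟩
  rintro _ ⟨b, rfl⟩
  have hb : (0 : ℝ) < b := b.2
  exact div_nonneg (by linarith) (hpos _ hb).le

lemma le_lyapunovFun {y c : ℝ} (h : ∀ a, 0 < a → c ≤ (a + y) / m a) : c ≤ lyapunovFun m y := by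
  have : Nonempty (Set.Ioi (0 : ℝ)) := ⟨⟨1, by simp⟩⟩
  exact le_ciInf fun a => h a a.2

lemma lyapunovFun_nonneg (hpos : ∀ a, 0 < a → 0 < m a) {y : ℝ} (hy : 0 ≤ y) :
    0 ≤ lyapunovFun m y :=
  le_lyapunovFun fun a ha => div_nonneg (by linarith) (hpos a ha).le

lemma lyapunovFun_le_two_mul (hpos : ∀ a, 0 < a → 0 < m a) {y : ℝ} (hy : 0 < y) :
    lyapunovFun m y ≤ 2 * (y / m y) :=
  (lyapunovFun_le hpos hy.le hy).trans_eq (by ring)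

lemma div_le_lyapunovFun (hpos : ∀ a, 0 < a → 0 < m a)
    (hmono : ∀ a b, 0 < a → a ≤ b → m a ≤ m b)
    (hscale : ∀ a b, 0 < a → a ≤ b → a * m b ≤ b * m a) {y : ℝ} (hy : 0 < y) :
    y / m y ≤ lyapunovFun m y := by
  refine le_lyapunovFun fun a ha => ?_
  rw [div_le_div_iff₀ (hpos y hy) (hpos a ha)]
  rcases le_total y a with h | h
  · nlinarith [hscale y a hy h, hpos y hy, mul_pos hy (hpos y hy)]
  · nlinarith [hmono a y ha h, hpos y hy, mul_pos ha (hpos y hy)]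

lemma lyapunovFun_mono (hpos : ∀ a, 0 < a → 0 < m a) {y z : ℝ} (hy : 0 ≤ y) (hyz : y ≤ z) :
    lyapunovFun m y ≤ lyapunovFun m z :=
  le_lyapunovFun fun a ha => (lyapunovFun_le hpos hy ha).trans <| by
    have := hpos a ha
    gcongr

/-- Concavity, in the form: slopes decrease. -/
lemma lyapunovFun_slope (hpos : ∀ a, 0 < a → 0 < m a) {u y z : ℝ} (hu : 0 ≤ u) (huy : u ≤ y)
    (hyz : y < z) :
    (y - u) * (lyapunovFun m z - lyapunovFun m y) ≤
      (z - y) * (lyapunovFun m y - lyapunovFun m u) := by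
  have hzu : 0 < z - u := by linarith
  have key : ((z - y) * lyapunovFun m u + (y - u) * lyapunovFun m z) / (z - u) ≤
      lyapunovFun m y := by
    refine le_lyapunovFun fun a ha => ?_
    have h1 := lyapunovFun_le hpos hu ha
    have h2 := lyapunovFun_le hpos (show 0 ≤ z by linarith) ha
    rw [div_le_iff₀ hzu]
    calc _ ≤ (z - y) * ((a + u) / m a) + (y - u) * ((a + z) / m a) := by
          refine add_le_add (mul_le_mul_of_nonneg_left h1 (by linarith))
            (mul_le_mul_of_nonneg_left h2 (by linarith))
      _ = _ := by ring
  rw [div_le_iff₀ hzu] at key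
  nlinarith

lemma lyapunovFun_add_le (hpos : ∀ a, 0 < a → 0 < m a)
    (hmono : ∀ a b, 0 < a → a ≤ b → m a ≤ m b) {y t : ℝ} (hy : 0 ≤ y) (ht : 0 < t) :
    lyapunovFun m (y + t) ≤ lyapunovFun m y + 2 * (t / m t) := by
  rw [← sub_le_iff_le_add]
  refine le_lyapunovFun fun a ha => ?_
  rw [sub_le_iff_le_add]
  have hma := hpos a ha
  have hmt := hpos t ht
  rcases le_total t a with h | h
  · refine (lyapunovFun_le hpos (by linarith) ha).trans ?_
    have h1 : t / m a ≤ t / m t := by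
      have := hmono t a ht h
      gcongr
    have h2 : 0 ≤ t / m t := by positivity
    calc (a + (y + t)) / m a = (a + y) / m a + t / m a := by ring
      _ ≤ _ := by linarith
  · refine (lyapunovFun_le hpos (by linarith) ht).trans ?_
    have h1 : y / m t ≤ (a + y) / m a := by
      have := hmono a t ha h
      refine div_le_div₀ (by linarith) (by linarith) hma this
    calc (t + (y + t)) / m t = y / m t + 2 * (t / m t) := by ring
      _ ≤ _ := by linarith

lemma lyapunovFun_mul_le (hpos : ∀ a, 0 < a → 0 < m a) {y c : ℝ} (hy : 0 ≤ y) (hc : 1 ≤ c) :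
    lyapunovFun m (c * y) ≤ c * lyapunovFun m y := by
  have hc0 : 0 < c := by linarith
  rw [← div_le_iff₀' hc0]
  refine le_lyapunovFun fun a ha => ?_
  have hma := hpos a ha
  rw [div_le_iff₀' hc0]
  refine (lyapunovFun_le hpos (by positivity) ha).trans ?_
  rw [← mul_div_assoc]
  gcongr
  nlinarith

lemma lyapunovFun_add_le' (hpos : ∀ a, 0 < a → 0 < m a) {y t : ℝ} (hy : 0 < y) (ht : 0 ≤ t) :
    lyapunovFun m (y + t) ≤ lyapunovFun m y + 2 * (t / m y) := by
  have h1 := lyapunovFun_mul_le hpos hy.le (c := 1 + t / y) (by simpa using by positivity)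
  have h2 := lyapunovFun_le_two_mul hpos hy
  have h3 : (1 + t / y) * y = y + t := by field_simp
  rw [h3] at h1
  refine h1.trans ?_
  have hmy := hpos y hy
  have : t / y * lyapunovFun m y ≤ t / y * (2 * (y / m y)) := by gcongr
  have e : t / y * (2 * (y / m y)) = 2 * (t / m y) := by field_simp
  linarith

end Lyapunov

/-! ### The drift of the Lyapunov function -/

section Drift

variable {F : Measure ℝ} [IsProbabilityMeasure F]

/-- The Lyapunov function of the walk with step law `F`, set to `0` on the negative half-line. -/
noncomputable def walkLyapunov (F : Measure ℝ) : ℝ → ℝ≥0∞ :=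
  (Set.Ici (0 : ℝ)).indicator
    fun y => ENNReal.ofReal (lyapunovFun (fun a => (truncNegMean F a).toReal) y)

lemma truncNegMean_toReal_pos (hneg : negPartMean F = ∞) (a : ℝ) (ha : 0 < a) :
    0 < (truncNegMean F a).toReal :=
  ENNReal.toReal_pos (truncNegMean_pos hneg ha).ne' (truncNegMean_ne_top a)

lemma truncNegMean_toReal_mono (a b : ℝ) (_ : 0 < a) (hab : a ≤ b) :
    (truncNegMean F a).toReal ≤ (truncNegMean F b).toReal :=
  ENNReal.toReal_mono (truncNegMean_ne_top b) (truncNegMean_mono hab)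

lemma truncNegMean_toReal_scale (a b : ℝ) (ha : 0 < a) (hab : a ≤ b) :
    a * (truncNegMean F b).toReal ≤ b * (truncNegMean F a).toReal := by
  have h := ENNReal.toReal_mono
    (ENNReal.mul_ne_top ENNReal.ofReal_ne_top (truncNegMean_ne_top a))
    (truncNegMean_scale (F := F) ha.le hab)
  rwa [ENNReal.toReal_mul, ENNReal.toReal_mul, ENNReal.toReal_ofReal ha.le,
    ENNReal.toReal_ofReal (ha.le.trans hab)] at h

lemma ofReal_div_truncNegMean (hneg : negPartMean F = ∞) {a : ℝ} (ha : 0 < a) (t : ℝ) :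
    ENNReal.ofReal (t / (truncNegMean F a).toReal) = ENNReal.ofReal t / truncNegMean F a := by
  rw [ENNReal.ofReal_div_of_pos (truncNegMean_toReal_pos hneg a ha),
    ENNReal.ofReal_toReal (truncNegMean_ne_top a)]

lemma walkLyapunov_mono (hneg : negPartMean F = ∞) : Monotone (walkLyapunov F) := by
  intro y z h
  unfold walkLyapunov
  by_cases hy : 0 ≤ y
  · rw [Set.indicator_of_mem (Set.mem_Ici.2 hy), Set.indicator_of_mem (Set.mem_Ici.2 (hy.trans h))]
    exact ENNReal.ofReal_le_ofReal (lyapunovFun_mono (truncNegMean_toReal_pos hneg) hy h)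
  · rw [Set.indicator_of_notMem (by simpa using hy)]
    exact zero_le

/-- The downward jumps contribute a drift of at least `1 / 7`. If the function grows substantially
between `y` and `8 * y`, concavity bounds its slope at `y` from below; if not, the truncated mean
must grow between `y` and `8 * y`, so a jump below `0` has probability of order `m y / y`. -/
lemma exists_decrement (hneg : negPartMean F = ∞) {y : ℝ} (hy : 0 < y) :
    ∃ d : ℝ → ℝ≥0∞, ENNReal.ofReal (1 / 7) ≤ ∫⁻ t, d t ∂F ∧
      (∀ t, 0 ≤ t → d t = 0) ∧
      ∀ t < 0, walkLyapunov F (y + t) + d t ≤ walkLyapunov F y := by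
  set m : ℝ → ℝ := fun a => (truncNegMean F a).toReal with hm
  have hpos : ∀ a, 0 < a → 0 < m a := truncNegMean_toReal_pos hneg
  have hmono : ∀ a b, 0 < a → a ≤ b → m a ≤ m b := truncNegMean_toReal_mono
  have hscale : ∀ a b, 0 < a → a ≤ b → a * m b ≤ b * m a := truncNegMean_toReal_scale
  have hmy := hpos y hy
  have hWy := div_le_lyapunovFun hpos hmono hscale hy
  have hLy : walkLyapunov F y = ENNReal.ofReal (lyapunovFun m y) :=
    Set.indicator_of_mem (Set.mem_Ici.2 hy.le) _
  rcases lt_or_ge (8 * y / m (8 * y)) (4 * (y / m y)) with h | h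
  · refine ⟨(Set.Iio (-y)).indicator fun _ => ENNReal.ofReal (lyapunovFun m y), ?_, ?_, ?_⟩
    · rw [lintegral_indicator_const measurableSet_Iio]
      have h1 : m (8 * y) ≤ m y + 7 * y * F.real (Set.Iio (-y)) := by
        have := truncNegMean_le_add (F := F) hy.le (show 0 ≤ 7 * y by positivity)
        have h2 := ENNReal.toReal_mono (by finiteness [truncNegMean_ne_top (F := F) y]) this
        rw [ENNReal.toReal_add (truncNegMean_ne_top y) (by finiteness), ENNReal.toReal_mul,
          ENNReal.toReal_ofReal (by positivity)] at h2
        rw [show 8 * y = y + 7 * y by ring]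
        exact h2
      have h2 : 2 * m y < m (8 * y) := by
        rw [← mul_div_assoc, div_lt_div_iff₀ (hpos _ (by positivity)) hmy] at h
        nlinarith
      have h3 : 1 / 7 ≤ lyapunovFun m y * F.real (Set.Iio (-y)) := by
        refine le_trans ?_ (mul_le_mul_of_nonneg_right hWy measureReal_nonneg)
        rw [div_mul_eq_mul_div, div_le_div_iff₀ (by norm_num) hmy]
        linarith
      refine (ENNReal.ofReal_le_ofReal h3).trans ?_
      rw [ENNReal.ofReal_mul (lyapunovFun_nonneg hpos hy.le), ofReal_measureReal]
    · exact fun t ht => Set.indicator_of_notMem (by simp; linarith) _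
    · intro t ht
      by_cases hty : t < -y
      · rw [Set.indicator_of_mem (Set.mem_Iio.2 hty), hLy, walkLyapunov,
          Set.indicator_of_notMem (by simp; linarith), zero_add]
      · rw [Set.indicator_of_notMem (by simpa using hty), add_zero]
        exact walkLyapunov_mono hneg (by linarith)
  · refine ⟨fun t => ENNReal.ofReal (1 / (7 * m y)) * ENNReal.ofReal (min (max (-t) 0) y),
      ?_, ?_, ?_⟩
    · rw [lintegral_const_mul _ (by fun_prop)]
      change _ ≤ _ * truncNegMean F y
      rw [← ENNReal.ofReal_toReal (truncNegMean_ne_top (F := F) y),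
        ← ENNReal.ofReal_mul (by positivity)]
      refine ENNReal.ofReal_le_ofReal (le_of_eq ?_)
      change _ = 1 / (7 * m y) * m y
      field_simp
    · intro t ht
      simp [ht, hy.le]
    · intro t ht
      beta_reduce
      rw [max_eq_left (by linarith), hLy, ← ENNReal.ofReal_mul (by positivity)]
      by_cases hty : y + t < 0
      · rw [walkLyapunov, Set.indicator_of_notMem (by simpa using hty), zero_add,
          min_eq_right (by linarith)]
        refine ENNReal.ofReal_le_ofReal (le_trans ?_ hWy)
        rw [div_mul_eq_mul_div, div_le_div_iff₀ (by positivity) hmy]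
        nlinarith [mul_pos hy hmy]
      · have hyt : 0 ≤ y + t := not_lt.1 hty
        rw [min_eq_left (by linarith), walkLyapunov, Set.indicator_of_mem (Set.mem_Ici.2 hyt),
          ← ENNReal.ofReal_add (lyapunovFun_nonneg hpos hyt)
            (mul_nonneg (by positivity) (by linarith))]
        refine ENNReal.ofReal_le_ofReal ?_
        have hs := lyapunovFun_slope hpos hyt (by linarith) (show y < 8 * y by linarith)
        have h8 := div_le_lyapunovFun hpos hmono hscale (show 0 < 8 * y by positivity)
        have h2 := lyapunovFun_le_two_mul hpos hy
        have h5 : -t * (2 * (y / m y)) ≤ 7 * y * (lyapunovFun m y - lyapunovFun m (y + t)) := by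
          have : -t * (2 * (y / m y)) ≤ -t * (lyapunovFun m (8 * y) - lyapunovFun m y) :=
            mul_le_mul_of_nonneg_left (by linarith) (by linarith)
          nlinarith
        have h6 : 2 / (7 * m y) * -t ≤ lyapunovFun m y - lyapunovFun m (y + t) := by
          have e : -t * (2 * (y / m y)) = 7 * y * (2 / (7 * m y) * -t) := by field_simp
          rw [e] at h5
          exact le_of_mul_le_mul_left h5 (by positivity)
        have h7 : 1 / (7 * m y) * -t ≤ 2 / (7 * m y) * -t := by
          refine mul_le_mul_of_nonneg_right ?_ (by linarith)
          gcongr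
          norm_num
        change lyapunovFun m (y + t) + _ ≤ _
        linarith

/-- Far from the origin the walk killed on the negative half-line has uniformly negative drift in
terms of the Lyapunov function: the upward jumps contribute `o(1)` because `E ξ⁺ / m(ξ⁺) < ∞` and
`m → ∞`. -/
theorem exists_drift (hneg : negPartMean F = ∞) (hK : tailConst F < ∞) :
    ∃ R : ℝ, 1 ≤ R ∧ ∀ y, R ≤ y →
      ∫⁻ t, walkLyapunov F (y + t) ∂F + ENNReal.ofReal (1 / 14) ≤ walkLyapunov F y := by
  have hlim := (tendsto_lintegral_increment hneg hK).eventually_le_const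
    (show (0 : ℝ≥0∞) < ENNReal.ofReal (1 / 14) by simp)
  obtain ⟨R, hR⟩ := eventually_atTop.1 hlim
  refine ⟨max R 1, le_max_right _ _, fun y hy => ?_⟩
  have hy0 : 0 < y := lt_of_lt_of_le one_pos ((le_max_right _ _).trans hy)
  have hβ := hR y ((le_max_left _ _).trans hy)
  obtain ⟨d, hd, hd0, hdle⟩ := exists_decrement hneg hy0
  have hpos := truncNegMean_toReal_pos (F := F) hneg
  have hmono := truncNegMean_toReal_mono (F := F)
  have hmeas : Measurable (walkLyapunov F) := (walkLyapunov_mono hneg).measurable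
  set β : ℝ → ℝ≥0∞ := fun t => min (2 * (ENNReal.ofReal t / truncNegMean F y))
    (2 * (ENNReal.ofReal t / truncNegMean F t)) with hβdef
  rw [← lintegral_indicator measurableSet_Ioi] at hβ
  have hpt : ∀ t, walkLyapunov F (y + t) + d t ≤
      walkLyapunov F y + (Set.Ioi (0 : ℝ)).indicator β t := by
    intro t
    rcases lt_trichotomy t 0 with ht | rfl | ht
    · exact (hdle t ht).trans le_self_add
    · simp [hd0 0 le_rfl]
    · rw [hd0 t ht.le, add_zero, Set.indicator_of_mem (Set.mem_Ioi.2 ht)]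
      unfold walkLyapunov
      rw [Set.indicator_of_mem (by simp; linarith), Set.indicator_of_mem (by simp; linarith)]
      have h1 := lyapunovFun_add_le' hpos hy0 ht.le
      have h2 := lyapunovFun_add_le hpos hmono hy0.le ht
      have h3 := lyapunovFun_nonneg hpos hy0.le
      have e : ∀ a, 0 < a → ENNReal.ofReal (2 * (t / (truncNegMean F a).toReal)) =
          2 * (ENNReal.ofReal t / truncNegMean F a) := fun a ha => by
        rw [ENNReal.ofReal_mul (by norm_num), ofReal_div_truncNegMean hneg ha]
        simp
      rw [hβdef, add_min]
      refine le_min ?_ ?_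
      · rw [← e y hy0, ← ENNReal.ofReal_add h3 (by have := hpos y hy0; positivity)]
        exact ENNReal.ofReal_le_ofReal h1
      · rw [← e t ht, ← ENNReal.ofReal_add h3 (by have := hpos t ht; positivity)]
        exact ENNReal.ofReal_le_ofReal h2
  have hint := lintegral_mono (μ := F) hpt
  rw [lintegral_add_left (by fun_prop), lintegral_add_left (by fun_prop)] at hint
  simp only [lintegral_const, measure_univ, mul_one] at hint
  have h7 : ENNReal.ofReal (1 / 7) = ENNReal.ofReal (1 / 14) + ENNReal.ofReal (1 / 14) := by
    rw [← ENNReal.ofReal_add (by norm_num) (by norm_num)]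
    norm_num
  have : ∫⁻ t, walkLyapunov F (y + t) ∂F + ENNReal.ofReal (1 / 14) + ENNReal.ofReal (1 / 14) ≤
      walkLyapunov F y + ENNReal.ofReal (1 / 14) := by
    rw [add_assoc, ← h7]
    exact (add_le_add_right hd _).trans (hint.trans (add_le_add_right hβ _))
  exact (ENNReal.add_le_add_iff_right ENNReal.ofReal_ne_top).1 this

end Drift

/-! ### Potentials of the killed walk -/

section Potential

/-- One step of the walk with step law `F`, killed outside `D`: the expectation of `f` at the new
position, on the event that this position is in `D`. The starting point `v` need not be in `D`. -/
noncomputable def killedStep (F : Measure ℝ) (D : Set ℝ) (f : ℝ → ℝ≥0∞) (v : ℝ) : ℝ≥0∞ :=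
  ∫⁻ t, D.indicator f (v + t) ∂F

/-- The expectation of `f(S₀) + ⋯ + f(Sₖ₋₁)` for the walk killed outside `D`, as a function of the
starting point. -/
noncomputable def killedPot (F : Measure ℝ) (D : Set ℝ) (f : ℝ → ℝ≥0∞) : ℕ → ℝ → ℝ≥0∞
  | 0 => fun _ => 0
  | k + 1 => fun v => f v + killedStep F D (killedPot F D f k) v

variable {F : Measure ℝ} {D D' : Set ℝ} {f g : ℝ → ℝ≥0∞}

lemma killedStep_mono (h : ∀ v ∈ D, f v ≤ g v) (v : ℝ) :
    killedStep F D f v ≤ killedStep F D g v := by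
  refine lintegral_mono fun t => ?_
  by_cases ht : v + t ∈ D
  · simpa [ht] using h _ ht
  · simp [ht]

lemma killedStep_mono_set (h : D ⊆ D') (v : ℝ) : killedStep F D f v ≤ killedStep F D' f v :=
  lintegral_mono fun _ => Set.indicator_le_indicator_of_subset h (fun _ => zero_le) _

lemma measurable_indicator_add (hD : MeasurableSet D) (hf : Measurable f) (v : ℝ) :
    Measurable fun t => D.indicator f (v + t) :=
  (hf.indicator hD).comp (measurable_const_add v)

lemma measurable_killedStep [SFinite F] (hD : MeasurableSet D) (hf : Measurable f) :
    Measurable (killedStep F D f) := by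
  have : Measurable fun p : ℝ × ℝ => D.indicator f (p.1 + p.2) :=
    (hf.indicator hD).comp (measurable_fst.add measurable_snd)
  exact this.lintegral_prod_right'

lemma measurable_killedPot [SFinite F] (hD : MeasurableSet D) (hf : Measurable f) (k : ℕ) :
    Measurable (killedPot F D f k) := by
  induction k with
  | zero => exact measurable_const
  | succ k ih => exact hf.add (measurable_killedStep hD ih)

lemma killedStep_add (hD : MeasurableSet D) (hf : Measurable f) (v : ℝ) :
    killedStep F D (fun u => f u + g u) v = killedStep F D f v + killedStep F D g v := by
  unfold killedStep
  rw [← lintegral_add_left (measurable_indicator_add hD hf v)]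
  refine lintegral_congr fun t => ?_
  by_cases ht : v + t ∈ D <;> simp [ht]

lemma killedStep_const_mul (hD : MeasurableSet D) (hf : Measurable f) (c : ℝ≥0∞) (v : ℝ) :
    killedStep F D (fun u => c * f u) v = c * killedStep F D f v := by
  unfold killedStep
  rw [← lintegral_const_mul _ (measurable_indicator_add hD hf v)]
  refine lintegral_congr fun t => ?_
  by_cases ht : v + t ∈ D <;> simp [ht]

lemma killedStep_diff_add (hDD : D ⊆ D') (hD : MeasurableSet D) (hf : Measurable f) (v : ℝ) :
    killedStep F D f v + killedStep F (D' \ D) f v = killedStep F D' f v := by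
  unfold killedStep
  rw [← lintegral_add_left (measurable_indicator_add hD hf v)]
  refine lintegral_congr fun t => ?_
  by_cases ht : v + t ∈ D
  · simp [ht, hDD ht]
  · by_cases ht' : v + t ∈ D' <;> simp [ht, ht']

/-- A nonnegative supersolution dominates the potential. -/
lemma killedPot_le_of_supersolution {V : Set ℝ} (hDV : D ⊆ V)
    (h : ∀ v ∈ V, f v + killedStep F D g v ≤ g v) (k : ℕ) : ∀ v ∈ V, killedPot F D f k v ≤ g v := by
  induction k with
  | zero => exact fun v _ => zero_le
  | succ k ih =>
    intro v hv
    refine le_trans ?_ (h v hv)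
    exact add_le_add_right (killedStep_mono (fun u hu => ih u (hDV hu)) v) _

lemma killedPot_mono_succ (k : ℕ) (v : ℝ) : killedPot F D f k v ≤ killedPot F D f (k + 1) v := by
  induction k generalizing v with
  | zero => exact zero_le
  | succ k ih => exact add_le_add_right (killedStep_mono (fun u _ => ih u) v) _

lemma killedPot_mono (v : ℝ) : Monotone fun k => killedPot F D f k v :=
  monotone_nat_of_le_succ fun k => killedPot_mono_succ k v

lemma killedPot_mono_set (h : D ⊆ D') (k : ℕ) (v : ℝ) :
    killedPot F D f k v ≤ killedPot F D' f k v := by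
  induction k generalizing v with
  | zero => exact le_rfl
  | succ k ih =>
    exact add_le_add_right ((killedStep_mono (fun u _ => ih u) v).trans (killedStep_mono_set h v)) _

/-- Continuity of the potential along increasing sequences of domains. -/
lemma tendsto_killedPot_iUnion [SFinite F] {E : ℕ → Set ℝ} (hE : Monotone E)
    (hEm : ∀ n, MeasurableSet (E n)) (hf : Measurable f) (k : ℕ) (v : ℝ) :
    Tendsto (fun n => killedPot F (E n) f k v) atTop (𝓝 (killedPot F (⋃ n, E n) f k v)) := by
  induction k generalizing v with
  | zero => exact tendsto_const_nhds
  | succ k ih =>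
    refine Tendsto.const_add _ ?_
    refine lintegral_tendsto_of_tendsto_of_monotone (fun n => ?_) ?_ ?_
    · exact (((measurable_killedPot (hEm n) hf k).indicator (hEm n)).comp
        (measurable_const_add v)).aemeasurable
    · refine Eventually.of_forall fun t a b hab => ?_
      exact (Set.indicator_le_indicator_of_subset (hE hab) (fun _ => zero_le) _).trans
        (Set.indicator_le_indicator (killedPot_mono_set (hE hab) k _))
    · refine Eventually.of_forall fun t => ?_
      by_cases ht : v + t ∈ ⋃ n, E n
      · obtain ⟨n, hn⟩ := Set.mem_iUnion.1 ht
        rw [Set.indicator_of_mem ht]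
        refine (ih (v + t)).congr' ?_
        filter_upwards [eventually_ge_atTop n] with i hi
        rw [Set.indicator_of_mem (hE hi hn)]
      · rw [Set.indicator_of_notMem ht]
        refine tendsto_const_nhds.congr fun n => ?_
        rw [Set.indicator_of_notMem fun h => ht (Set.mem_iUnion_of_mem n h)]

/-- `v ↦ E_v τ`, the mean lifetime of the walk killed outside `D`, started at `v`. -/
noncomputable def meanLifetime (F : Measure ℝ) (D : Set ℝ) (v : ℝ) : ℝ≥0∞ :=
  ⨆ k, killedPot F D (fun _ => 1) k v

lemma meanLifetime_eq [SFinite F] (hD : MeasurableSet D) (v : ℝ) :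
    meanLifetime F D v = 1 + killedStep F D (meanLifetime F D) v := by
  have h1 : killedStep F D (meanLifetime F D) v =
      ⨆ k, killedStep F D (killedPot F D (fun _ => 1) k) v := by
    unfold killedStep
    rw [← lintegral_iSup]
    · refine lintegral_congr fun t => ?_
      by_cases ht : v + t ∈ D <;> simp [ht, meanLifetime]
    · exact fun k => ((measurable_killedPot hD measurable_const k).indicator hD).comp
        (measurable_const_add v)
    · exact fun a b hab t => Set.indicator_le_indicator (killedPot_mono _ hab)
  rw [h1, ENNReal.add_iSup]
  refine le_antisymm (iSup_le fun k => ?_) (iSup_le fun k => ?_)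
  · exact (killedPot_mono_succ k v).trans
      (le_iSup (fun k => 1 + killedStep F D (killedPot F D (fun _ => 1) k) v) k)
  · exact le_iSup (fun k => killedPot F D (fun _ => 1) k v) (k + 1)

lemma one_le_meanLifetime [SFinite F] (hD : MeasurableSet D) (v : ℝ) : 1 ≤ meanLifetime F D v := by
  rw [meanLifetime_eq hD]
  exact le_self_add

lemma meanLifetime_mono (hD : IsUpperSet D) : Monotone (meanLifetime F D) := by
  intro u v huv
  refine iSup_mono fun k => ?_
  induction k generalizing u v with
  | zero => exact le_rfl
  | succ k ih =>
    refine add_le_add_right (lintegral_mono fun t => ?_) _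
    have huv' : u + t ≤ v + t := by linarith
    by_cases ht : u + t ∈ D
    · rw [Set.indicator_of_mem ht, Set.indicator_of_mem (hD huv' ht)]
      exact ih huv'
    · rw [Set.indicator_of_notMem ht]
      exact zero_le

end Potential

/-! ### The mean lifetime on the positive half-line -/

section Lifetime

variable {F : Measure ℝ} [IsProbabilityMeasure F]

lemma ratio_mono (hneg : negPartMean F = ∞) {a b : ℝ} (ha : 0 ≤ a) (hab : a ≤ b) :
    ENNReal.ofReal a / truncNegMean F a ≤ ENNReal.ofReal b / truncNegMean F b := by
  rcases ha.eq_or_lt with rfl | ha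
  · simp
  have hb := ha.trans_le hab
  rw [← ofReal_div_truncNegMean hneg ha, ← ofReal_div_truncNegMean hneg hb]
  refine ENNReal.ofReal_le_ofReal ?_
  rw [div_le_div_iff₀ (truncNegMean_toReal_pos hneg a ha) (truncNegMean_toReal_pos hneg b hb)]
  exact truncNegMean_toReal_scale a b ha hab

lemma meanLifetime_le (hneg : negPartMean F = ∞) (hK : tailConst F < ∞) {D : Set ℝ}
    (hD : D ⊆ Set.Ici 0) :
    ∃ C : ℝ≥0∞, C ≠ ∞ ∧ ∀ z, 0 ≤ z →
      meanLifetime F D z ≤ C * (ENNReal.ofReal (z + 1) / truncNegMean F (z + 1)) := by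
  obtain ⟨R, hR1, hR⟩ := exists_drift hneg hK
  have hmeas : Measurable (walkLyapunov F) := (walkLyapunov_mono hneg).measurable
  have hpos := truncNegMean_toReal_pos (F := F) hneg
  have h14 : (14 : ℝ≥0∞) * ENNReal.ofReal (1 / 14) = 1 := by
    rw [show (14 : ℝ≥0∞) = ENNReal.ofReal 14 by simp, ← ENNReal.ofReal_mul (by norm_num)]
    norm_num
  have key : ∀ z, 0 ≤ z → meanLifetime F D z ≤ 14 * walkLyapunov F (z + R) := by
    intro z hz
    refine iSup_le fun k => ?_
    refine killedPot_le_of_supersolution (g := fun z => 14 * walkLyapunov F (z + R)) hD ?_ k z hz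
    intro v hv
    have h1 : killedStep F D (fun z => 14 * walkLyapunov F (z + R)) v ≤
        14 * ∫⁻ t, walkLyapunov F (v + R + t) ∂F := by
      unfold killedStep
      rw [← lintegral_const_mul _ (by fun_prop)]
      refine lintegral_mono fun t => ?_
      refine (Set.indicator_le_self _ _ _).trans ?_
      rw [add_right_comm]
    have hv0 : (0 : ℝ) ≤ v := hv
    calc _ ≤ 1 + 14 * ∫⁻ t, walkLyapunov F (v + R + t) ∂F := add_le_add_right h1 _
      _ = 14 * (∫⁻ t, walkLyapunov F (v + R + t) ∂F + ENNReal.ofReal (1 / 14)) := by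
          rw [mul_add, h14, add_comm]
      _ ≤ _ := by gcongr; exact hR _ (by linarith)
  refine ⟨14 * ENNReal.ofReal (2 * R), by finiteness, fun z hz => (key z hz).trans ?_⟩
  rw [mul_assoc, ← ofReal_div_truncNegMean hneg (by linarith),
    ← ENNReal.ofReal_mul (by linarith)]
  gcongr
  rw [walkLyapunov, Set.indicator_of_mem (by simp; linarith)]
  refine ENNReal.ofReal_le_ofReal ?_
  have h1 := lyapunovFun_mono hpos (y := z + R) (z := R * (z + 1)) (by linarith) (by nlinarith)
  have h2 := lyapunovFun_mul_le hpos (y := z + 1) (by linarith) hR1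
  have h3 := lyapunovFun_le_two_mul hpos (y := z + 1) (by linarith)
  have h4 := mul_le_mul_of_nonneg_left h3 (by linarith : 0 ≤ R)
  linarith

lemma meanLifetime_ne_top (hneg : negPartMean F = ∞) (hK : tailConst F < ∞) {D : Set ℝ}
    (hD : D ⊆ Set.Ici 0) {z : ℝ} (hz : 0 ≤ z) : meanLifetime F D z ≠ ∞ := by
  obtain ⟨C, hC, h⟩ := meanLifetime_le hneg hK hD
  refine ne_top_of_le_ne_top (ENNReal.mul_ne_top hC ?_) (h z hz)
  exact ENNReal.div_ne_top ENNReal.ofReal_ne_top (truncNegMean_pos hneg (by linarith)).ne'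

lemma lintegral_meanLifetime_ne_top (hneg : negPartMean F = ∞) (hK : tailConst F < ∞) {D : Set ℝ}
    (hD : D ⊆ Set.Ici 0) : ∫⁻ t in Set.Ici (0 : ℝ), meanLifetime F D t ∂F ≠ ∞ := by
  obtain ⟨C, hC, h⟩ := meanLifetime_le hneg hK hD
  have hm : Measurable (truncNegMean F) := truncNegMean_mono.measurable
  set w : ℝ → ℝ≥0∞ := fun t => ENNReal.ofReal t / truncNegMean F t with hw
  have hwm : Measurable w := by fun_prop
  have h1 : w 1 ≠ ∞ :=
    ENNReal.div_ne_top ENNReal.ofReal_ne_top (truncNegMean_pos hneg one_pos).ne'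
  have hsub : ∀ t, 0 ≤ t → w (t + 1) ≤ w 1 + (Set.Ioi (0 : ℝ)).indicator w t := by
    intro t ht
    rcases ht.eq_or_lt with rfl | ht
    · simp
    · rw [Set.indicator_of_mem (Set.mem_Ioi.2 ht)]
      simp only [hw]
      rw [ENNReal.ofReal_add ht.le zero_le_one, ENNReal.add_div, add_comm]
      exact add_le_add (ENNReal.div_le_div_left (truncNegMean_mono (by linarith)) _)
        (ENNReal.div_le_div_left (truncNegMean_mono (by linarith)) _)
  refine ne_top_of_le_ne_top (b := C * (w 1 + tailConst F)) (by finiteness) ?_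
  calc ∫⁻ t in Set.Ici (0 : ℝ), meanLifetime F D t ∂F
      ≤ ∫⁻ t in Set.Ici (0 : ℝ), C * (w 1 + (Set.Ioi (0 : ℝ)).indicator w t) ∂F := by
        refine setLIntegral_mono' measurableSet_Ici fun t ht => (h t ht).trans ?_
        gcongr
        exact hsub t ht
    _ ≤ ∫⁻ t, C * (w 1 + (Set.Ioi (0 : ℝ)).indicator w t) ∂F := setLIntegral_le_lintegral _ _
    _ = C * (w 1 + tailConst F) := by
        rw [lintegral_const_mul _ (by measurability), lintegral_add_left measurable_const,
          lintegral_indicator measurableSet_Ioi]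
        simp [tailConst, hw]

end Lifetime

/-! ### Consequences of membership in the class `𝓢_F` -/

section ClassS

variable {F G : Measure ℝ}

lemma measurable_tail_sub (x : ℝ) : Measurable fun u : ℝ => F (Set.Ioi (x - u)) := by
  have : Monotone fun u : ℝ => F (Set.Ioi (x - u)) := fun u v h =>
    measure_mono (Set.Ioi_subset_Ioi (by linarith))
  exact this.measurable

lemma tendsto_tail_zero (μ : Measure ℝ) [IsFiniteMeasure μ] :
    Tendsto (fun x : ℝ => μ (Set.Ioi x)) atTop (𝓝 0) := by
  have h := tendsto_measure_iInter_atTop (μ := μ) (s := fun x : ℝ => Set.Ioi x)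
    (fun x => measurableSet_Ioi.nullMeasurableSet) (fun a b h => Set.Ioi_subset_Ioi h)
    ⟨0, measure_ne_top _ _⟩
  have e : ⋂ x : ℝ, Set.Ioi x = ∅ := by
    ext z
    simp only [Set.mem_iInter, Set.mem_Ioi, Set.mem_empty_iff_false, iff_false, not_forall]
    exact ⟨z, lt_irrefl z⟩
  rw [e, measure_empty] at h
  exact h

lemma measure_Ioi_eq_add (μ : Measure ℝ) {a b : ℝ} (h : a ≤ b) :
    μ (Set.Ioi a) = μ (Set.Ioc a b) + μ (Set.Ioi b) := by
  rw [← Set.Ioc_union_Ioi_eq_Ioi h, measure_union _ measurableSet_Ioi]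
  exact Set.disjoint_left.2 fun x hx hx' => not_lt.2 hx.2 hx'

lemma InClassS.tail_ne_zero (hS : InClassS F G) (x : ℝ) : F (Set.Ioi x) ≠ 0 := by
  obtain ⟨_, _, h⟩ := hS
  have h1 := h.eventually (lt_mem_nhds (show (0 : ℝ) < 1 by norm_num))
  obtain ⟨z, hz, hxz⟩ := (h1.and (eventually_ge_atTop x)).exists
  intro h0
  have : F (Set.Ioi z) = 0 := measure_mono_null (Set.Ioi_subset_Ioi hxz) h0
  simp [Measure.real, this] at hz

lemma weightedTail_zero : weightedTail F 0 = tailConst F := by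
  simp [weightedTail, tailConst]

variable [IsProbabilityMeasure F]

lemma InClassS.eventually_le (hS : InClassS F G) {η : ℝ} (hη : 0 < η) :
    ∀ᶠ x in atTop, ∫⁻ u in Set.Icc 0 x, F (Set.Ioi (x - u)) ∂G ≤
      (1 + ENNReal.ofReal η) * F (Set.Ioi x) := by
  have hpos := hS.tail_ne_zero
  obtain ⟨hG, _, h⟩ := hS
  filter_upwards [h.eventually (gt_mem_nhds (show (1 : ℝ) < 1 + η by linarith))] with x hx
  have hx0 : 0 < F.real (Set.Ioi x) := ENNReal.toReal_pos (hpos x) (measure_ne_top _ _)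
  rw [div_lt_iff₀ hx0] at hx
  have hfin : ∫⁻ u in Set.Icc 0 x, F (Set.Ioi (x - u)) ∂G ≠ ∞ := by
    refine ne_top_of_le_ne_top (measure_ne_top G (Set.Icc 0 x)) ?_
    calc _ ≤ ∫⁻ u in Set.Icc 0 x, 1 ∂G := lintegral_mono fun u => prob_le_one
      _ = _ := by simp
  have e : ∫ u in Set.Icc 0 x, F.real (Set.Ioi (x - u)) ∂G =
      (∫⁻ u in Set.Icc 0 x, F (Set.Ioi (x - u)) ∂G).toReal :=
    integral_toReal (measurable_tail_sub x).aemeasurable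
      (Eventually.of_forall fun u => measure_lt_top _ _)
  rw [e] at hx
  rw [← ENNReal.ofReal_toReal hfin, ← ofReal_measureReal, ← ENNReal.ofReal_one,
    ← ENNReal.ofReal_add zero_le_one hη.le, ← ENNReal.ofReal_mul (by linarith)]
  exact ENNReal.ofReal_le_ofReal hx.le

/-- In the convolution of a law of class `𝓢_F` with `F`, large values of the first summand
contribute little. -/
lemma InClassS.eventually_lintegral_Ioc_le (hS : InClassS F G) {η : ℝ≥0∞} (hη : η ≠ 0) {A : ℝ}
    (hA : 0 ≤ A) :
    ∀ᶠ x in atTop, ∫⁻ u in Set.Ioc A x, F (Set.Ioi (x - u)) ∂G ≤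
      (η + G (Set.Ioi A)) * F (Set.Ioi x) := by
  obtain ⟨η', hη', hle⟩ : ∃ η' : ℝ, 0 < η' ∧ ENNReal.ofReal η' ≤ η := by
    obtain ⟨c, hc, hcη⟩ := ENNReal.lt_iff_exists_nnreal_btwn.1 (pos_iff_ne_zero.2 hη)
    exact ⟨c, by exact_mod_cast hc, by simpa using hcη.le⟩
  have hG := hS.1
  have hG0 := hS.2.1
  filter_upwards [hS.eventually_le hη', eventually_ge_atTop A] with x hx hAx
  have hsplit : ∫⁻ u in Set.Icc 0 x, F (Set.Ioi (x - u)) ∂G =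
      ∫⁻ u in Set.Icc 0 A, F (Set.Ioi (x - u)) ∂G +
        ∫⁻ u in Set.Ioc A x, F (Set.Ioi (x - u)) ∂G := by
    rw [← Set.Icc_union_Ioc_eq_Icc hA hAx, lintegral_union measurableSet_Ioc]
    exact Set.disjoint_left.2 fun u hu hu' => not_lt.2 hu.2 hu'.1
  have hlow : G (Set.Icc 0 A) * F (Set.Ioi x) ≤ ∫⁻ u in Set.Icc 0 A, F (Set.Ioi (x - u)) ∂G := by
    rw [mul_comm, ← setLIntegral_const]
    exact setLIntegral_mono' measurableSet_Icc fun u hu =>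
      measure_mono (Set.Ioi_subset_Ioi (by linarith [hu.1]))
  have hone : 1 = G (Set.Icc 0 A) + G (Set.Ioi A) := by
    have h1 : (Set.univ : Set ℝ) = Set.Iio 0 ∪ (Set.Icc 0 A ∪ Set.Ioi A) := by
      ext z
      simp only [Set.mem_univ, Set.mem_union, Set.mem_Iio, Set.mem_Icc, Set.mem_Ioi, true_iff]
      by_cases hz : z < 0
      · exact Or.inl hz
      · by_cases hz' : A < z
        · exact Or.inr (Or.inr hz')
        · exact Or.inr (Or.inl ⟨not_lt.1 hz, not_lt.1 hz'⟩)
    refine le_antisymm ?_ ?_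
    · rw [← measure_univ (μ := G), h1]
      refine (measure_union_le _ _).trans ?_
      rw [hG0, zero_add]
      exact measure_union_le _ _
    · rw [← measure_union _ measurableSet_Ioi]
      · exact prob_le_one
      · exact Set.disjoint_left.2 fun u hu hu' => not_lt.2 hu.2 hu'
  have key : G (Set.Icc 0 A) * F (Set.Ioi x) + ∫⁻ u in Set.Ioc A x, F (Set.Ioi (x - u)) ∂G ≤
      G (Set.Icc 0 A) * F (Set.Ioi x) + (η + G (Set.Ioi A)) * F (Set.Ioi x) := by
    calc _ ≤ ∫⁻ u in Set.Icc 0 x, F (Set.Ioi (x - u)) ∂G := by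
          rw [hsplit]
          exact add_le_add_left hlow _
      _ ≤ _ := hx
      _ ≤ (1 + η) * F (Set.Ioi x) := by gcongr
      _ = _ := by
          rw [hone]
          ring
  exact (ENNReal.add_le_add_iff_left (by finiteness)).1 key

lemma weightedTail_ne_zero (hF : ∀ x, F (Set.Ioi x) ≠ 0) (x : ℝ) : weightedTail F x ≠ 0 := by
  have hm : Measurable (truncNegMean F) := truncNegMean_mono.measurable
  intro h
  unfold weightedTail at h
  rw [lintegral_eq_zero_iff (by fun_prop), EventuallyEq, ae_restrict_iff' measurableSet_Ioi] at h
  refine hF x ?_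
  rw [measure_eq_zero_iff_ae_notMem]
  filter_upwards [h] with t ht hxt
  have := ht hxt
  simp only [Pi.zero_apply, ENNReal.div_eq_zero_iff, ENNReal.ofReal_eq_zero] at this
  rcases this with h | h
  · linarith [Set.mem_Ioi.1 hxt]
  · exact truncNegMean_ne_top _ h

/-- Local lower bound for the weighted tail law: its mass on `(a, x]` controls the contribution to
the tail at `a` of the jumps that end in `(a, x]`. -/
lemma IsWeightedTailLaw.setLIntegral_le (hneg : negPartMean F = ∞) (hK : tailConst F < ∞)
    (hF : ∀ x, F (Set.Ioi x) ≠ 0) (hG : IsWeightedTailLaw F G) {a x : ℝ} (ha : 0 ≤ a) :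
    ∫⁻ t in Set.Ioc a x, ENNReal.ofReal (t - a) / truncNegMean F (t - a) ∂F ≤
      tailConst F * G (Set.Ioc a x) := by
  rcases le_or_gt a x with hax | hax
  swap
  · simp [Set.Ioc_eq_empty_of_le hax.le]
  have hK0 : tailConst F ≠ 0 := by
    rw [← weightedTail_zero]
    exact weightedTail_ne_zero hF 0
  have htail : ∀ y, 0 ≤ y → tailConst F * G (Set.Ioi y) = weightedTail F y := fun y hy => by
    rw [hG.2.2 y hy, ENNReal.mul_div_cancel hK0 hK.ne]
  have hfin : weightedTail F x ≠ ∞ := by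
    have := hG.1
    rw [← htail x (ha.trans hax)]
    finiteness
  have hsplit : tailConst F * G (Set.Ioc a x) + weightedTail F x = weightedTail F a := by
    rw [← htail x (ha.trans hax), ← htail a ha, ← mul_add, ← measure_Ioi_eq_add G hax]
  have hle : ∫⁻ t in Set.Ioc a x, ENNReal.ofReal (t - a) / truncNegMean F (t - a) ∂F +
      weightedTail F x ≤ weightedTail F a := by
    unfold weightedTail
    rw [← Set.Ioc_union_Ioi_eq_Ioi hax, lintegral_union measurableSet_Ioi
      (Set.disjoint_left.2 fun u hu hu' => not_lt.2 hu.2 hu')]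
    refine add_le_add_right (setLIntegral_mono' measurableSet_Ioi fun t ht => ?_) _
    exact ratio_mono hneg (by linarith [Set.mem_Ioi.1 ht]) (by linarith)
  rw [← hsplit] at hle
  exact (ENNReal.add_le_add_iff_right hfin).1 hle

/-- `F` is long-tailed. -/
lemma eventually_measure_Ioc_le (hK : tailConst F < ∞) (hG : IsWeightedTailLaw F G)
    (hS : InClassS F G) {c : ℝ} (hc : 0 ≤ c) {δ : ℝ≥0∞} (hδ : δ ≠ 0) :
    ∀ᶠ x in atTop, F (Set.Ioc (x - c) x) ≤ δ * F (Set.Ioi x) := by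
  have hGp := hS.1
  have hGc : G (Set.Ioi c) ≠ 0 := by
    rw [hG.2.2 c hc]
    exact ENNReal.div_ne_zero.2 ⟨weightedTail_ne_zero hS.tail_ne_zero c, hK.ne⟩
  obtain ⟨x₀, hx₀c, hx₀⟩ : ∃ x₀, c ≤ x₀ ∧ G (Set.Ioc c x₀) ≠ 0 := by
    obtain ⟨x₀, h1, h2⟩ := (((tendsto_tail_zero G).eventually
      (gt_mem_nhds (pos_iff_ne_zero.2 hGc))).and (eventually_ge_atTop c)).exists
    refine ⟨x₀, h2, fun h => ?_⟩
    rw [measure_Ioi_eq_add G h2, h, zero_add] at h1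
    exact lt_irrefl _ h1
  set g := G (Set.Ioc c x₀) with hg
  have hη : g * δ / 2 ≠ 0 := by simp [hx₀, hδ]
  filter_upwards [hS.eventually_lintegral_Ioc_le hη hc, eventually_ge_atTop x₀,
    (tendsto_tail_zero G).eventually (gt_mem_nhds (pos_iff_ne_zero.2 hη))] with x hx hxx₀ hGx
  have hcx := hx₀c.trans hxx₀
  have hlow : G (Set.Ioc c x) * (F (Set.Ioc (x - c) x) + F (Set.Ioi x)) ≤
      ∫⁻ u in Set.Ioc c x, F (Set.Ioi (x - u)) ∂G := by
    rw [← measure_Ioi_eq_add F (by linarith), mul_comm, ← setLIntegral_const]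
    exact setLIntegral_mono' measurableSet_Ioc fun u hu =>
      measure_mono (Set.Ioi_subset_Ioi (by linarith [hu.1]))
  have h1 : G (Set.Ioc c x) * F (Set.Ioc (x - c) x) + G (Set.Ioc c x) * F (Set.Ioi x) ≤
      g * δ * F (Set.Ioi x) + G (Set.Ioc c x) * F (Set.Ioi x) := by
    rw [← mul_add]
    refine (hlow.trans hx).trans ?_
    rw [measure_Ioi_eq_add G hcx, ← add_mul]
    refine mul_le_mul' ?_ le_rfl
    calc g * δ / 2 + (G (Set.Ioc c x) + G (Set.Ioi x))
        ≤ g * δ / 2 + (G (Set.Ioc c x) + g * δ / 2) := by gcongr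
      _ = g * δ / 2 + g * δ / 2 + G (Set.Ioc c x) := by ring
      _ = g * δ + G (Set.Ioc c x) := by rw [ENNReal.add_halves]
  have h2 : g * F (Set.Ioc (x - c) x) ≤ g * (δ * F (Set.Ioi x)) := by
    rw [← mul_assoc]
    refine le_trans ?_ ((ENNReal.add_le_add_iff_right (by finiteness)).1 h1)
    gcongr
    exact measure_mono (Set.Ioc_subset_Ioc_right hxx₀)
  exact (ENNReal.mul_le_mul_iff_right hx₀ (measure_ne_top _ _)).1 h2

lemma setLIntegral_measure_Ioc_le [IsProbabilityMeasure G] {A x : ℝ} :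
    ∫⁻ s in Set.Iic (x - A), G (Set.Ioc (x - s) x) ∂F ≤
      ∫⁻ u in Set.Ioc A x, F (Set.Ioi (x - u)) ∂G := by
  set E : Set (ℝ × ℝ) := {p | p.1 ≤ x - A ∧ x - p.1 < p.2 ∧ p.2 ≤ x} with hE
  have hEm : MeasurableSet E := by
    refine (measurableSet_le measurable_fst measurable_const).inter
      ((measurableSet_lt (by fun_prop) measurable_snd).inter
        (measurableSet_le measurable_snd measurable_const))
  calc ∫⁻ s in Set.Iic (x - A), G (Set.Ioc (x - s) x) ∂F
      = ∫⁻ s, ∫⁻ u, E.indicator (fun _ => (1 : ℝ≥0∞)) (s, u) ∂G ∂F := by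
        rw [← lintegral_indicator measurableSet_Iic]
        refine lintegral_congr fun s => ?_
        by_cases hs : s ≤ x - A
        · rw [Set.indicator_of_mem (Set.mem_Iic.2 hs), ← lintegral_indicator_one measurableSet_Ioc]
          refine lintegral_congr fun u => ?_
          by_cases hu : u ∈ Set.Ioc (x - s) x
          · rw [Set.indicator_of_mem hu, Set.indicator_of_mem (show (s, u) ∈ E from ⟨hs, hu⟩)]
            rfl
          · rw [Set.indicator_of_notMem hu, Set.indicator_of_notMem fun h => hu h.2]
        · rw [Set.indicator_of_notMem (by simpa using hs)]
          symm
          rw [lintegral_eq_zero_iff (by measurability)]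
          exact Eventually.of_forall fun u => Set.indicator_of_notMem (fun h => hs h.1) _
    _ = ∫⁻ u, ∫⁻ s, E.indicator (fun _ => (1 : ℝ≥0∞)) (s, u) ∂F ∂G :=
        lintegral_lintegral_swap (measurable_const.indicator hEm).aemeasurable
    _ ≤ ∫⁻ u, (Set.Ioc A x).indicator (fun u => F (Set.Ioi (x - u))) u ∂G := by
        refine lintegral_mono fun u => ?_
        by_cases hu : u ∈ Set.Ioc A x
        · rw [Set.indicator_of_mem hu, ← lintegral_indicator_one measurableSet_Ioi]
          refine lintegral_mono fun s => ?_
          by_cases hs : (s, u) ∈ E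
          · rw [Set.indicator_of_mem hs, Set.indicator_of_mem (by
              have := hs.2.1; simp only at this; simp; linarith)]
            rfl
          · rw [Set.indicator_of_notMem hs]
            exact zero_le
        · rw [Set.indicator_of_notMem hu]
          refine le_of_eq ?_
          rw [lintegral_eq_zero_iff (by measurability)]
          refine Eventually.of_forall fun s => Set.indicator_of_notMem (fun h => hu ⟨?_, h.2.2⟩) _
          have h1 := h.1
          have h2 := h.2.1
          simp only at h1 h2
          linarith
    _ = _ := lintegral_indicator measurableSet_Ioc _

/-- For two independent jumps, neither exceeding `y`, the expectation of `N` at the overshoot of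
their sum over `y`. -/
noncomputable def doubleJump (F : Measure ℝ) (N : ℝ → ℝ≥0∞) (y : ℝ) : ℝ≥0∞ :=
  ∫⁻ s in Set.Iic y, ∫⁻ t in Set.Iic y, (Set.Ici 0).indicator N (s + t - y) ∂F ∂F

lemma doubleJump_le [IsProbabilityMeasure G] (hneg : negPartMean F = ∞) (hK : tailConst F < ∞)
    (hG : IsWeightedTailLaw F G) (hF : ∀ x, F (Set.Ioi x) ≠ 0) {N : ℝ → ℝ≥0∞} (hN : Monotone N)
    {C : ℝ≥0∞}
    (hNC : ∀ z, 0 ≤ z → N z ≤ C * (ENNReal.ofReal (z + 1) / truncNegMean F (z + 1)))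
    {A : ℝ} (hA : 0 ≤ A) (y : ℝ) :
    doubleJump F N y ≤
      C * tailConst F * ∫⁻ u in Set.Ioc A (y - 1), F (Set.Ioi (y - 1 - u)) ∂G +
      F (Set.Ioc (y - (1 + A)) y) * ∫⁻ t in Set.Ici (0 : ℝ), N t ∂F +
      F (Set.Ioc (y - 1) y) * ∫⁻ t in Set.Ici (0 : ℝ), N t ∂F := by
  have hm : Measurable (truncNegMean F) := truncNegMean_mono.measurable
  have hNm : Measurable N := hN.measurable
  set I := ∫⁻ t in Set.Ici (0 : ℝ), N t ∂F with hI
  have hinner : ∀ s ≤ y, ∫⁻ t in Set.Iic y, (Set.Ici 0).indicator N (s + t - y) ∂F ≤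
      (Set.Iic (y - 1 - A)).indicator
        (fun s => C * tailConst F * G (Set.Ioc (y - 1 - s) (y - 1))) s +
      (Set.Ioc (y - (1 + A)) y).indicator (fun _ => I) s +
      (Set.Ici 0).indicator N s * F (Set.Ioc (y - 1) y) := by
    intro s hsy
    by_cases hs : s ≤ y - 1 - A
    · rw [Set.indicator_of_mem (Set.mem_Iic.2 hs)]
      have h1 : ∫⁻ t in Set.Iic y, (Set.Ici 0).indicator N (s + t - y) ∂F ≤
          ∫⁻ t, ((Set.Ioc (y - 1 - s) (y - 1)).indicator (fun t => C *
            (ENNReal.ofReal (t - (y - 1 - s)) / truncNegMean F (t - (y - 1 - s)))) t +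
          (Set.Ioc (y - 1) y).indicator (fun _ => (Set.Ici 0).indicator N s) t) ∂F := by
        rw [← lintegral_indicator measurableSet_Iic]
        refine lintegral_mono fun t => ?_
        by_cases ht : t ≤ y
        swap
        · rw [Set.indicator_of_notMem (by simpa using ht)]
          exact zero_le
        rw [Set.indicator_of_mem (Set.mem_Iic.2 ht)]
        by_cases hst : 0 ≤ s + t - y
        swap
        · rw [Set.indicator_of_notMem (by simpa using hst)]
          exact zero_le
        rw [Set.indicator_of_mem (Set.mem_Ici.2 hst)]
        by_cases ht1 : t ≤ y - 1
        · rw [Set.indicator_of_mem (show t ∈ Set.Ioc _ _ from ⟨by linarith, ht1⟩)]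
          refine le_add_right ((hNC _ hst).trans_eq ?_)
          rw [show s + t - y + 1 = t - (y - 1 - s) by ring]
        · refine le_add_left ?_
          rw [Set.indicator_of_mem (show t ∈ Set.Ioc (y - 1) y from ⟨not_le.1 ht1, ht⟩),
            Set.indicator_of_mem (show s ∈ Set.Ici (0 : ℝ) by simp; linarith)]
          exact hN (by linarith)
      refine h1.trans ?_
      rw [lintegral_add_right _ (measurable_const.indicator measurableSet_Ioc),
        lintegral_indicator measurableSet_Ioc, lintegral_indicator_const measurableSet_Ioc,
        lintegral_const_mul _ (by fun_prop), mul_assoc C]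
      refine add_le_add_left (le_add_right ?_) _
      gcongr
      exact IsWeightedTailLaw.setLIntegral_le hneg hK hF hG (by linarith)
    · have hs' := not_le.1 hs
      rw [Set.indicator_of_notMem (by simpa using hs), zero_add,
        Set.indicator_of_mem (show s ∈ Set.Ioc _ _ from ⟨by linarith, hsy⟩)]
      refine le_add_right ?_
      rw [hI, ← lintegral_indicator measurableSet_Ici, ← lintegral_indicator measurableSet_Iic]
      refine lintegral_mono fun t => ?_
      by_cases ht : t ≤ y
      swap
      · rw [Set.indicator_of_notMem (by simpa using ht)]
        exact zero_le
      rw [Set.indicator_of_mem (Set.mem_Iic.2 ht)]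
      by_cases hst : 0 ≤ s + t - y
      swap
      · rw [Set.indicator_of_notMem (by simpa using hst)]
        exact zero_le
      rw [Set.indicator_of_mem (Set.mem_Ici.2 hst),
        Set.indicator_of_mem (show t ∈ Set.Ici (0 : ℝ) by simp; linarith)]
      exact hN (by linarith)
  have hGm : Measurable fun s => G (Set.Ioc (y - 1 - s) (y - 1)) := by
    have : Monotone fun s => G (Set.Ioc (y - 1 - s) (y - 1)) := fun a b h =>
      measure_mono (Set.Ioc_subset_Ioc_left (by linarith))
    exact this.measurable
  calc doubleJump F N y ≤ ∫⁻ s in Set.Iic y, ((Set.Iic (y - 1 - A)).indicator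
        (fun s => C * tailConst F * G (Set.Ioc (y - 1 - s) (y - 1))) s +
      (Set.Ioc (y - (1 + A)) y).indicator (fun _ => I) s +
      (Set.Ici 0).indicator N s * F (Set.Ioc (y - 1) y)) ∂F :=
        setLIntegral_mono' measurableSet_Iic hinner
    _ ≤ _ := setLIntegral_le_lintegral _ _
    _ = C * tailConst F * ∫⁻ s in Set.Iic (y - 1 - A), G (Set.Ioc (y - 1 - s) (y - 1)) ∂F +
        I * F (Set.Ioc (y - (1 + A)) y) + I * F (Set.Ioc (y - 1) y) := by
        rw [lintegral_add_right _ ((hNm.indicator measurableSet_Ici).mul_const _),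
          lintegral_add_right _ (measurable_const.indicator measurableSet_Ioc),
          lintegral_mul_const _ (hNm.indicator measurableSet_Ici),
          lintegral_indicator measurableSet_Iic, lintegral_indicator measurableSet_Ici,
          lintegral_indicator_const measurableSet_Ioc, lintegral_const_mul _ hGm]
    _ ≤ _ := by
        have h := setLIntegral_measure_Ioc_le (F := F) (G := G) (A := A) (x := y - 1)
        rw [mul_comm I, mul_comm I]
        gcongr

/-- The principle of a single big jump: two jumps that only jointly exceed a high level are
negligible against one jump exceeding it, even when weighted by the mean lifetime `N` at the
overshoot. -/
theorem eventually_doubleJump_le (hneg : negPartMean F = ∞) (hK : tailConst F < ∞)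
    (hG : IsWeightedTailLaw F G) (hS : InClassS F G) {N : ℝ → ℝ≥0∞} (hN : Monotone N)
    {C : ℝ≥0∞} (hC : C ≠ ∞)
    (hNC : ∀ z, 0 ≤ z → N z ≤ C * (ENNReal.ofReal (z + 1) / truncNegMean F (z + 1)))
    (hNI : ∫⁻ t in Set.Ici (0 : ℝ), N t ∂F ≠ ∞) {δ : ℝ≥0∞} (hδ : δ ≠ 0) :
    ∀ᶠ y in atTop, doubleJump F N y ≤ δ * F (Set.Ioi y) := by
  have hGp := hS.1
  set I := ∫⁻ t in Set.Ici (0 : ℝ), N t ∂F with hI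
  set X := 4 * (C * tailConst F) + 2 * I + 1 with hX
  have hXt : X ≠ ∞ := by finiteness
  have hX1 : 1 ≤ X := le_add_self
  set η := min 1 (δ / X) with hη
  have hη0 : η ≠ 0 := by
    rw [hη, ← pos_iff_ne_zero]
    exact lt_min one_pos (ENNReal.div_pos hδ hXt)
  obtain ⟨A, hGA, hA⟩ := (((tendsto_tail_zero G).eventually
    (gt_mem_nhds (pos_iff_ne_zero.2 hη0))).and (eventually_ge_atTop 0)).exists
  have hshift : Tendsto (fun y : ℝ => y - 1) atTop atTop :=
    tendsto_atTop_add_const_right _ _ tendsto_id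
  filter_upwards [hshift.eventually (hS.eventually_lintegral_Ioc_le hη0 hA),
    eventually_measure_Ioc_le hK hG hS zero_le_one hη0,
    eventually_measure_Ioc_le hK hG hS (c := 1 + A) (by linarith) hη0] with y h1 h2 h3
  refine (doubleJump_le hneg hK hG hS.tail_ne_zero hN hNC hA y).trans ?_
  have h4 : F (Set.Ioi (y - 1)) ≤ 2 * F (Set.Ioi y) := by
    rw [measure_Ioi_eq_add F (show y - 1 ≤ y by linarith), two_mul]
    refine add_le_add_left (h2.trans ?_) _
    calc η * F (Set.Ioi y) ≤ 1 * F (Set.Ioi y) := by gcongr; exact min_le_left _ _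
      _ = _ := one_mul _
  calc _ ≤ C * tailConst F * ((η + η) * (2 * F (Set.Ioi y))) + η * F (Set.Ioi y) * I +
        η * F (Set.Ioi y) * I := by
        gcongr
        refine h1.trans ?_
        gcongr
    _ = η * (4 * (C * tailConst F) + 2 * I) * F (Set.Ioi y) := by ring
    _ ≤ δ / X * X * F (Set.Ioi y) := by
        gcongr
        · exact min_le_right _ _
        · exact le_self_add
    _ = δ * F (Set.Ioi y) := by
        rw [ENNReal.div_mul_cancel (zero_lt_one.trans_le hX1).ne' hXt]

end ClassS

/-! ### A supersolution for the exceedance probability -/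

section Supersolution

/-- The mean lifetime of the walk started at `v` and killed below the level `(x - s)⁺` instead of
below `0` (by translation, `meanLifetime` at `v - (x - s)⁺`), and `0` if `v` is itself below that
level. For `x ≤ s` the start `v` need not be in `B`, so that `v = 0` is covered also when
`B = (0, ∞)`. -/
noncomputable def jumpPot (F : Measure ℝ) (B : Set ℝ) (x s v : ℝ) : ℝ≥0∞ :=
  if x ≤ s then meanLifetime F B v else B.indicator (meanLifetime F B) (v - x + s)

/-- The average of `jumpPot` over an independent jump `s`. It counts the times at which such a jump
would take the walk from `v` beyond `x`, up to the first descent below `(x - s)⁺`, and is an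
approximate solution of the equation for the probability that this walk, killed outside `B`,
exceeds `x`. -/
noncomputable def exceedPot (F : Measure ℝ) (B : Set ℝ) (x v : ℝ) : ℝ≥0∞ :=
  ∫⁻ s, jumpPot F B x s v ∂F

variable {F : Measure ℝ} {B : Set ℝ}

lemma measurable_jumpPot [SFinite F] (hB : IsUpperSet B) (hBm : MeasurableSet B) (x : ℝ) :
    Measurable fun p : ℝ × ℝ => jumpPot F B x p.1 p.2 := by
  have hN : Measurable (meanLifetime F B) := (meanLifetime_mono hB).measurable
  have hI : Measurable (B.indicator (meanLifetime F B)) := hN.indicator hBm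
  exact Measurable.ite (measurableSet_le measurable_const measurable_fst) (by fun_prop)
    (by fun_prop)

lemma measurable_exceedPot [SFinite F] (hB : IsUpperSet B) (hBm : MeasurableSet B) (x : ℝ) :
    Measurable (exceedPot F B x) :=
  (measurable_jumpPot hB hBm x).lintegral_prod_left'

lemma exceedPot_zero_le (hB0 : B ⊆ Set.Ici 0) (x : ℝ) :
    exceedPot F B x 0 ≤ F (Set.Ici x) * meanLifetime F B 0 := by
  rw [mul_comm, ← lintegral_indicator_const measurableSet_Ici]
  refine lintegral_mono fun s => ?_
  unfold jumpPot
  split_ifs with h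
  · rw [Set.indicator_of_mem (Set.mem_Ici.2 h)]
  · rw [Set.indicator_of_notMem fun h' => ?_]
    · exact zero_le
    · have : 0 ≤ 0 - x + s := hB0 h'
      linarith

variable [IsProbabilityMeasure F]

lemma tail_le_exceedPot (hBm : MeasurableSet B) (hBpos : Set.Ioi 0 ⊆ B) (x v : ℝ) :
    F (Set.Ioi (x - v)) ≤ exceedPot F B x v := by
  rw [← lintegral_indicator_one measurableSet_Ioi]
  refine lintegral_mono fun s => ?_
  by_cases hs : x - v < s
  · rw [Set.indicator_of_mem (Set.mem_Ioi.2 hs), jumpPot]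
    split_ifs
    · exact one_le_meanLifetime hBm v
    · rw [Set.indicator_of_mem (hBpos (by simp; linarith))]
      exact one_le_meanLifetime hBm _
  · rw [Set.indicator_of_notMem (by simpa using hs)]
    exact zero_le

/-- Up to the double jump term, `exceedPot` decreases in one step by at least the probability of
jumping beyond `x`. Above the level `(x - s)⁺` the mean lifetime decreases by `1` on average; below
it, `jumpPot` is `0` and can become positive only by a jump `t` with `s + t ≥ x - v`. -/
theorem exceedPot_drift (hB : IsUpperSet B) (hBm : MeasurableSet B) (hBpos : Set.Ioi 0 ⊆ B)
    (hB0 : B ⊆ Set.Ici 0) {x v : ℝ} :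
    killedStep F (B ∩ Set.Iic x) (exceedPot F B x) v + F (Set.Ioi (x - v)) ≤
      exceedPot F B x v + doubleJump F (meanLifetime F B) (x - v) := by
  set N := meanLifetime F B with hN
  have hNm : Measurable N := (meanLifetime_mono hB).measurable
  set D := B ∩ Set.Iic x with hD
  have hDm : MeasurableSet D := hBm.inter measurableSet_Iic
  have hj := measurable_jumpPot (F := F) hB hBm x
  have hswap : killedStep F D (exceedPot F B x) v =
      ∫⁻ s, ∫⁻ t, D.indicator (jumpPot F B x s) (v + t) ∂F ∂F := by
    have hmeas : Measurable fun p : ℝ × ℝ => D.indicator (jumpPot F B x p.2) (v + p.1) := by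
      have h1 : Measurable fun p : ℝ × ℝ => jumpPot F B x p.2 (v + p.1) :=
        hj.comp (measurable_snd.prodMk (measurable_fst.const_add v))
      have h2 : MeasurableSet {p : ℝ × ℝ | v + p.1 ∈ D} := (measurable_fst.const_add v) hDm
      convert h1.indicator h2 using 2 with p
      by_cases hp : v + p.1 ∈ D <;> simp [hp]
    rw [← lintegral_lintegral_swap (f := fun t s => D.indicator (jumpPot F B x s) (v + t))
      hmeas.aemeasurable]
    refine lintegral_congr fun t => ?_
    by_cases ht : v + t ∈ D <;> simp [ht, exceedPot]
  have hjm : Measurable fun s => jumpPot F B x s v :=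
    hj.comp (measurable_id.prodMk measurable_const)
  rw [hswap, ← lintegral_indicator_one measurableSet_Ioi,
    ← lintegral_add_right _ (measurable_one.indicator measurableSet_Ioi), doubleJump,
    ← lintegral_indicator measurableSet_Iic, exceedPot, ← lintegral_add_left hjm]
  refine lintegral_mono fun s => ?_
  by_cases hs : x ≤ s
  · refine le_add_right ?_
    have e : jumpPot F B x s = N := funext fun u => by simp [jumpPot, hs, hN]
    rw [e, hN, meanLifetime_eq hBm v, add_comm]
    refine add_le_add ?_ (killedStep_mono_set Set.inter_subset_left v)
    exact Set.indicator_le_self _ _ _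
  have e : jumpPot F B x s = fun u => B.indicator N (u - x + s) :=
    funext fun u => by simp [jumpPot, hs, hN]
  rw [e]
  beta_reduce
  by_cases hvs : v - x + s ∈ B
  · refine le_add_right ?_
    rw [Set.indicator_of_mem hvs, hN, meanLifetime_eq hBm (v - x + s), add_comm]
    refine add_le_add (Set.indicator_le_self _ _ _) (lintegral_mono fun t => ?_)
    refine (Set.indicator_le_self _ _ _).trans ?_
    rw [show v + t - x + s = v - x + s + t by ring]
  · have hsy : s ≤ x - v := by
      by_contra h
      exact hvs (hBpos (by simp; linarith))
    rw [Set.indicator_of_notMem hvs, zero_add, Set.indicator_of_notMem (by simpa using hsy),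
      add_zero, Set.indicator_of_mem (Set.mem_Iic.2 hsy), ← lintegral_indicator measurableSet_Iic]
    refine lintegral_mono fun t => ?_
    by_cases ht : v + t ∈ D
    swap
    · rw [Set.indicator_of_notMem ht]
      exact zero_le
    have htx : v + t ≤ x := ht.2
    rw [Set.indicator_of_mem ht, Set.indicator_of_mem (show t ∈ Set.Iic (x - v) by simp; linarith),
      show v + t - x + s = s + t - (x - v) by ring]
    exact Set.indicator_le_indicator_of_subset hB0 (fun _ => zero_le) _

lemma exceedPot_supersolution (hB : IsUpperSet B) (hBm : MeasurableSet B) (hBpos : Set.Ioi 0 ⊆ B)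
    (hB0 : B ⊆ Set.Ici 0) {x v : ℝ} {δ : ℝ≥0∞} (hδ : δ ≤ 1)
    (hdj : doubleJump F (meanLifetime F B) (x - v) ≤ δ * F (Set.Ioi (x - v))) :
    (1 - δ) * F (Set.Ioi (x - v)) + killedStep F (B ∩ Set.Iic x) (exceedPot F B x) v ≤
      exceedPot F B x v := by
  have hδt : δ ≠ ∞ := ne_top_of_le_ne_top (by simp) hδ
  have h := (exceedPot_drift hB hBm hBpos hB0).trans (add_le_add_right hdj _)
  have e : F (Set.Ioi (x - v)) = (1 - δ) * F (Set.Ioi (x - v)) + δ * F (Set.Ioi (x - v)) := by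
    rw [← add_mul, tsub_add_cancel_of_le hδ, one_mul]
  nth_rw 1 [e] at h
  rw [← add_assoc, add_comm (killedStep _ _ _ _)] at h
  exact (ENNReal.add_le_add_iff_right (by finiteness)).1 h

/-- The probability that the walk started at `v` exceeds the level `x`, before it leaves `B`, at
one of its first `k` steps. -/
noncomputable def exceedProb (F : Measure ℝ) (B : Set ℝ) (x : ℝ) (k : ℕ) (v : ℝ) : ℝ≥0∞ :=
  killedPot F (B ∩ Set.Iic x) (fun v => F (Set.Ioi (x - v))) k v

lemma exceedProb_le_one (x : ℝ) (k : ℕ) {v : ℝ} (hv : v ≤ x) : exceedProb F B x k v ≤ 1 := by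
  refine killedPot_le_of_supersolution (g := fun _ => 1) (V := Set.Iic x) Set.inter_subset_right
    (fun u hu => ?_) k v hv
  have h1 : killedStep F (B ∩ Set.Iic x) (fun _ => 1) u ≤ F (Set.Iic (x - u)) := by
    rw [← lintegral_indicator_one measurableSet_Iic]
    refine lintegral_mono fun t => ?_
    by_cases ht : u + t ∈ B ∩ Set.Iic x
    · have : u + t ≤ x := ht.2
      rw [Set.indicator_of_mem ht, Set.indicator_of_mem (by simp; linarith)]
      rfl
    · rw [Set.indicator_of_notMem ht]
      exact zero_le
  refine (add_le_add_right h1 _).trans ?_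
  rw [add_comm, ← measure_union _ measurableSet_Ioi]
  · exact prob_le_one
  · exact Set.disjoint_left.2 fun a ha hb => not_lt.2 (Set.mem_Iic.1 ha) (Set.mem_Ioi.1 hb)

/-- A bound of the right order for the exceedance probability, uniform in the starting point. -/
lemma exceedProb_le_mul (hB : IsUpperSet B) (hBm : MeasurableSet B) (hBpos : Set.Ioi 0 ⊆ B)
    (hB0 : B ⊆ Set.Ici 0) (hF : ∀ x, F (Set.Ioi x) ≠ 0)
    (hdj : ∀ᶠ y in atTop, doubleJump F (meanLifetime F B) y ≤ 2⁻¹ * F (Set.Ioi y)) :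
    ∃ C : ℝ≥0∞, C ≠ ∞ ∧ ∀ x k v, v ≤ x →
      exceedProb F B x k v ≤ C * exceedPot F B x v := by
  obtain ⟨Y, hY⟩ := eventually_atTop.1 hdj
  refine ⟨2 + (F (Set.Ioi Y))⁻¹, by finiteness [hF Y], fun x k => ?_⟩
  set C := 2 + (F (Set.Ioi Y))⁻¹ with hC
  have hgm := measurable_exceedPot (F := F) hB hBm x
  induction k with
  | zero => exact fun v _ => zero_le
  | succ k ih =>
    intro v hvx
    rcases lt_or_ge (x - v) Y with h | h
    · refine (exceedProb_le_one x (k + 1) hvx).trans ?_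
      have h1 : F (Set.Ioi Y) ≤ exceedPot F B x v :=
        (measure_mono (Set.Ioi_subset_Ioi h.le)).trans (tail_le_exceedPot hBm hBpos x v)
      calc 1 = (F (Set.Ioi Y))⁻¹ * F (Set.Ioi Y) :=
            (ENNReal.inv_mul_cancel (hF Y) (measure_ne_top _ _)).symm
        _ ≤ C * exceedPot F B x v := by
            gcongr
            exact le_add_self
    · have hsup := exceedPot_supersolution hB hBm hBpos hB0 (by simp) (hY _ h)
      rw [ENNReal.one_sub_inv_two] at hsup
      calc exceedProb F B x (k + 1) v
          ≤ F (Set.Ioi (x - v)) +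
            killedStep F (B ∩ Set.Iic x) (fun u => C * exceedPot F B x u) v :=
            add_le_add_right (killedStep_mono (fun u hu => ih u hu.2) v) _
        _ ≤ C * (2⁻¹ * F (Set.Ioi (x - v))) +
            C * killedStep F (B ∩ Set.Iic x) (exceedPot F B x) v := by
            rw [killedStep_const_mul (hBm.inter measurableSet_Iic) hgm]
            gcongr
            rw [← mul_assoc]
            refine le_mul_of_one_le_left' ?_
            calc (1 : ℝ≥0∞) = 2 * 2⁻¹ := (ENNReal.mul_inv_cancel (by simp) (by simp)).symm
              _ ≤ C * 2⁻¹ := by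
                gcongr
                exact le_self_add
        _ ≤ _ := by
            rw [← mul_add]
            gcongr

/-- Splitting at the first visit to the strip `(x - Y, x]`, with `p` the probability of jumping
beyond `x` from below the strip and `r` the expectation of `exceedPot` at the entrance to the
strip. As `(1 - δ) * p` nearly exhausts `exceedPot F B x 0` by the lower bound for `p`, the last
inequality makes `r` small. -/
lemma exceedProb_split (hB : IsUpperSet B) (hBm : MeasurableSet B) (hBpos : Set.Ioi 0 ⊆ B)
    (hB0 : B ⊆ Set.Ici 0) {x Y : ℝ} (hY : 0 ≤ Y) (hxY : Y ≤ x) {C δ : ℝ≥0∞} (hδ : δ ≤ 1)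
    (hC : ∀ k v, v ≤ x → exceedProb F B x k v ≤ C * exceedPot F B x v)
    (hdj : ∀ y, Y ≤ y → doubleJump F (meanLifetime F B) y ≤ δ * F (Set.Ioi y)) (k : ℕ) :
    ∃ p r : ℝ≥0∞,
      p = killedPot F (B ∩ Set.Iic (x - Y)) (fun v => F (Set.Ioi (x - v))) k 0 ∧
      exceedProb F B x k 0 ≤ p + C * r ∧ (1 - δ) * p + r ≤ exceedPot F B x 0 := by
  set D := B ∩ Set.Iic (x - Y) with hD
  set Dx := B ∩ Set.Iic x with hDx
  have hDm : MeasurableSet D := hBm.inter measurableSet_Iic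
  have hDxm : MeasurableSet Dx := hBm.inter measurableSet_Iic
  have hDD : D ⊆ Dx := Set.inter_subset_inter_right _ (Set.Iic_subset_Iic.2 (by linarith))
  set g := exceedPot F B x with hg
  have hgm : Measurable g := measurable_exceedPot hB hBm x
  set f : ℝ → ℝ≥0∞ := fun v => F (Set.Ioi (x - v)) with hf
  have hfm : Measurable f := measurable_tail_sub x
  set q := killedStep F (Dx \ D) g with hq
  have hqm : Measurable q := measurable_killedStep (hDxm.diff hDm) hgm
  have hpm := fun k => measurable_killedPot (F := F) hDm hfm k
  have hrm := fun k => measurable_killedPot (F := F) hDm hqm k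
  refine ⟨killedPot F D f k 0, killedPot F D q k 0, rfl, ?_, ?_⟩
  · have : ∀ k v, exceedProb F B x k v ≤ killedPot F D f k v + C * killedPot F D q k v := by
      intro k
      induction k with
      | zero => exact fun v => zero_le
      | succ k ih =>
        intro v
        have hem : Measurable (exceedProb F B x k) := measurable_killedPot hDxm hfm k
        calc exceedProb F B x (k + 1) v
            = f v + (killedStep F D (exceedProb F B x k) v +
              killedStep F (Dx \ D) (exceedProb F B x k) v) := by
              rw [killedStep_diff_add hDD hDm hem]
              rfl
          _ ≤ f v + (killedStep F D (fun u => killedPot F D f k u + C * killedPot F D q k u) v +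
              killedStep F (Dx \ D) (fun u => C * g u) v) := by
              gcongr
              · exact killedStep_mono (fun u _ => ih u) v
              · exact killedStep_mono (fun u hu => hC k u hu.1.2) v
          _ = f v + (killedStep F D (killedPot F D f k) v +
              C * killedStep F D (killedPot F D q k) v + C * q v) := by
              rw [killedStep_add hDm (hpm k), killedStep_const_mul hDm (hrm k),
                killedStep_const_mul (hDxm.diff hDm) hgm]
          _ = _ := by
              simp only [killedPot]
              ring
    exact this k 0
  · have : ∀ k v, v ≤ x - Y →
        (1 - δ) * killedPot F D f k v + killedPot F D q k v ≤ g v := by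
      intro k
      induction k with
      | zero => exact fun v _ => by simp [killedPot]
      | succ k ih =>
        intro v hvx
        calc (1 - δ) * killedPot F D f (k + 1) v + killedPot F D q (k + 1) v
            = (1 - δ) * f v + (q v + killedStep F D
              (fun u => (1 - δ) * killedPot F D f k u + killedPot F D q k u) v) := by
              rw [killedStep_add hDm ((hpm k).const_mul _), killedStep_const_mul hDm (hpm k)]
              simp only [killedPot]
              ring
          _ ≤ (1 - δ) * f v + (q v + killedStep F D g v) := by
              gcongr
              exact killedStep_mono (fun u hu => ih u hu.2) v
          _ = (1 - δ) * f v + killedStep F Dx g v := by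
              rw [add_comm (q v), killedStep_diff_add hDD hDm hgm]
          _ ≤ g v := exceedPot_supersolution hB hBm hBpos hB0 hδ (hdj _ (by linarith))
    exact this k 0 (by linarith)

end Supersolution

/-! ### Asymptotics of the exceedance probability -/

section Asymptotics

variable {F G : Measure ℝ} [IsProbabilityMeasure F] {B : Set ℝ}

/-- Only the walk below a fixed level is needed for a sharp lower bound. -/
lemma eventually_mul_le_killedPot (hBm : MeasurableSet B) (hB0 : B ⊆ Set.Ici 0) (Y : ℝ)
    {c : ℝ≥0∞} (hc : c < meanLifetime F B 0) :
    ∃ k₀, ∀ᶠ x in atTop, ∀ k, k₀ ≤ k → c * F (Set.Ioi x) ≤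
      killedPot F (B ∩ Set.Iic (x - Y)) (fun v => F (Set.Ioi (x - v))) k 0 := by
  obtain ⟨k₀, hk₀⟩ := lt_iSup_iff.1 hc
  have hE : Monotone fun n : ℕ => B ∩ Set.Iic (n : ℝ) := fun a b h =>
    Set.inter_subset_inter_right _ (Set.Iic_subset_Iic.2 (Nat.cast_le.2 h))
  have hU : ⋃ n : ℕ, B ∩ Set.Iic (n : ℝ) = B := by
    rw [← Set.inter_iUnion, Set.inter_eq_left]
    exact fun z _ => Set.mem_iUnion.2 (exists_nat_ge z)
  have hlim := tendsto_killedPot_iUnion (F := F) hE (fun n => hBm.inter measurableSet_Iic)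
    (measurable_const (a := (1 : ℝ≥0∞))) k₀ 0
  rw [hU] at hlim
  obtain ⟨n, hn⟩ := (hlim.eventually (lt_mem_nhds hk₀)).exists
  refine ⟨k₀, ?_⟩
  filter_upwards [eventually_ge_atTop (n + Y)] with x hx k hk
  have hEm : MeasurableSet (B ∩ Set.Iic (n : ℝ)) := hBm.inter measurableSet_Iic
  have h1 : ∀ k v, 0 ≤ v → F (Set.Ioi x) * killedPot F (B ∩ Set.Iic (n : ℝ)) (fun _ => 1) k v ≤
      killedPot F (B ∩ Set.Iic (n : ℝ)) (fun v => F (Set.Ioi (x - v))) k v := by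
    intro k
    induction k with
    | zero => exact fun v _ => by simp [killedPot]
    | succ k ih =>
      intro v hv
      simp only [killedPot]
      rw [mul_add, mul_one, ← killedStep_const_mul hEm
        (measurable_killedPot hEm measurable_const k)]
      refine add_le_add (measure_mono (Set.Ioi_subset_Ioi (by linarith))) ?_
      exact killedStep_mono (fun u hu => ih u (hB0 hu.1)) v
  calc c * F (Set.Ioi x) ≤ F (Set.Ioi x) *
        killedPot F (B ∩ Set.Iic (n : ℝ)) (fun _ => 1) k₀ 0 := by
        rw [mul_comm]
        gcongr
    _ ≤ killedPot F (B ∩ Set.Iic (n : ℝ)) (fun v => F (Set.Ioi (x - v))) k₀ 0 := h1 k₀ 0 le_rfl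
    _ ≤ killedPot F (B ∩ Set.Iic (x - Y)) (fun v => F (Set.Ioi (x - v))) k₀ 0 :=
        killedPot_mono_set
          (Set.inter_subset_inter_right _ (Set.Iic_subset_Iic.2 (by linarith))) _ _
    _ ≤ _ := killedPot_mono 0 hk

lemma eventually_exceedPot_zero_le (hK : tailConst F < ∞) (hG : IsWeightedTailLaw F G)
    (hS : InClassS F G) (hB0 : B ⊆ Set.Ici 0) {δ : ℝ≥0∞} (hδ : δ ≠ 0) :
    ∀ᶠ x in atTop, exceedPot F B x 0 ≤ (1 + δ) * F (Set.Ioi x) * meanLifetime F B 0 := by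
  filter_upwards [eventually_measure_Ioc_le hK hG hS zero_le_one hδ] with x hx
  refine (exceedPot_zero_le hB0 x).trans ?_
  gcongr
  calc F (Set.Ici x) ≤ F (Set.Ioi (x - 1)) := measure_mono (Set.Ici_subset_Ioi.2 (by linarith))
    _ = F (Set.Ioc (x - 1) x) + F (Set.Ioi x) := measure_Ioi_eq_add F (by linarith)
    _ ≤ δ * F (Set.Ioi x) + F (Set.Ioi x) := by gcongr
    _ = _ := by ring

/-- The analytic form of the theorem: the probability of exceeding `x` before leaving `B` is
asymptotic to the mean lifetime times the tail of one step. -/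
theorem tendsto_exceedProb (hneg : negPartMean F = ∞) (hK : tailConst F < ∞)
    (hG : IsWeightedTailLaw F G) (hS : InClassS F G)
    (hB : IsUpperSet B) (hBm : MeasurableSet B) (hBpos : Set.Ioi 0 ⊆ B) (hB0 : B ⊆ Set.Ici 0) :
    Tendsto (fun x : ℝ => (⨆ k, exceedProb F B x k 0).toReal / F.real (Set.Ioi x)) atTop
      (𝓝 (meanLifetime F B 0).toReal) := by
  set e := (meanLifetime F B 0).toReal with he
  have hefin := meanLifetime_ne_top hneg hK hB0 le_rfl
  have heq : meanLifetime F B 0 = ENNReal.ofReal e := (ENNReal.ofReal_toReal hefin).symm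
  have he0 : 0 < e := ENNReal.toReal_pos
    (zero_lt_one.trans_le (one_le_meanLifetime hBm 0)).ne' hefin
  have hF := hS.tail_ne_zero
  have hFpos : ∀ x, 0 < F.real (Set.Ioi x) := fun x =>
    ENNReal.toReal_pos (hF x) (measure_ne_top _ _)
  obtain ⟨C₀, hC₀, hNC⟩ := meanLifetime_le hneg hK hB0
  have hdj : ∀ δ : ℝ≥0∞, δ ≠ 0 →
      ∀ᶠ y in atTop, doubleJump F (meanLifetime F B) y ≤ δ * F (Set.Ioi y) := fun δ hδ =>
    eventually_doubleJump_le hneg hK hG hS (meanLifetime_mono hB) hC₀ hNC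
      (lintegral_meanLifetime_ne_top hneg hK hB0) hδ
  obtain ⟨C, hC, hcrude⟩ := exceedProb_le_mul hB hBm hBpos hB0 hF (hdj 2⁻¹ (by simp))
  have hsup1 : ∀ᶠ x : ℝ in atTop, ⨆ k, exceedProb F B x k 0 ≤ 1 := by
    filter_upwards [eventually_ge_atTop 0] with x hx
    exact iSup_le fun k => exceedProb_le_one x k hx
  refine tendsto_order.2 ⟨fun a ha => ?_, fun b hb => ?_⟩
  · obtain ⟨c, hac, hce⟩ := exists_between ha
    rcases lt_or_ge a 0 with ha0 | ha0
    · exact Eventually.of_forall fun x => ha0.trans_le (by positivity)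
    have hc0 : 0 ≤ c := ha0.trans hac.le
    obtain ⟨k₀, hk₀⟩ := eventually_mul_le_killedPot hBm hB0 0
      (c := ENNReal.ofReal c) (by rw [heq]; exact (ENNReal.ofReal_lt_ofReal_iff he0).2 hce)
    filter_upwards [hk₀, hsup1] with x hx hx1
    refine hac.trans_le ?_
    rw [le_div_iff₀ (hFpos x)]
    have h1 := (hx k₀ le_rfl)
    rw [sub_zero] at h1
    have h2 := h1.trans (le_iSup (fun k => exceedProb F B x k 0) k₀)
    have h3 := ENNReal.toReal_mono (ne_top_of_le_ne_top (by simp) hx1) h2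
    rwa [ENNReal.toReal_mul, ENNReal.toReal_ofReal hc0] at h3
  · -- the bound produced by `exceedProb_split` tends to `e` as `δ → 0`
    have hlim : Tendsto (fun δ : ℝ => (1 + δ) * e / (1 - δ) +
        C.toReal * ((1 + δ) * e - (1 - δ) * (e - δ))) (𝓝[>] 0) (𝓝 e) := by
      have hcont : ContinuousAt (fun δ : ℝ => (1 + δ) * e / (1 - δ) +
          C.toReal * ((1 + δ) * e - (1 - δ) * (e - δ))) 0 := by
        refine ContinuousAt.add (ContinuousAt.div (by fun_prop) (by fun_prop) (by norm_num)) ?_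
        fun_prop
      have := hcont.tendsto
      simp only [add_zero, sub_zero, one_mul, div_one, sub_self, mul_zero] at this
      exact this.mono_left nhdsWithin_le_nhds
    obtain ⟨δ, ⟨hδb, hδ0⟩, hδ1, hδe⟩ := (((hlim.eventually (gt_mem_nhds hb)).and
      self_mem_nhdsWithin).and (((gt_mem_nhds (show (0 : ℝ) < 1 by norm_num)).filter_mono
        nhdsWithin_le_nhds).and ((gt_mem_nhds he0).filter_mono nhdsWithin_le_nhds))).exists
    have hδ0' : (0 : ℝ) < δ := hδ0
    have hδne : ENNReal.ofReal δ ≠ 0 := by simpa using hδ0'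
    obtain ⟨Y', hY'⟩ := eventually_atTop.1 (hdj _ hδne)
    set Y := max Y' 0 with hY
    obtain ⟨k₀, hk₀⟩ := eventually_mul_le_killedPot hBm hB0 Y
      (c := ENNReal.ofReal (e - δ)) (by
        rw [heq]; exact (ENNReal.ofReal_lt_ofReal_iff he0).2 (by linarith))
    filter_upwards [hk₀, eventually_ge_atTop Y,
      eventually_exceedPot_zero_le hK hG hS hB0 hδne] with x hx hxY hg
    refine lt_of_le_of_lt ?_ hδb
    rw [div_le_iff₀ (hFpos x)]
    refine ENNReal.toReal_le_of_le_ofReal ?_ ?_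
    · have : 0 ≤ (1 + δ) * e - (1 - δ) * (e - δ) := by nlinarith
      have h1 : 0 < 1 - δ := by linarith
      have := (hFpos x).le
      positivity
    have hbound : ∀ k, k₀ ≤ k → exceedProb F B x k 0 ≤ ENNReal.ofReal (((1 + δ) * e / (1 - δ) +
        C.toReal * ((1 + δ) * e - (1 - δ) * (e - δ))) * F.real (Set.Ioi x)) := by
      intro k hk
      obtain ⟨p, r, hp, hle, hpr⟩ := exceedProb_split hB hBm hBpos hB0 (le_max_right Y' 0) hxY
        (δ := ENNReal.ofReal δ) (ENNReal.ofReal_le_one.2 hδ1.le) (hcrude x)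
        (fun y hy => hY' y ((le_max_left _ _).trans hy)) k
      have hlow := hx k hk
      rw [← hp] at hlow
      have hpr' := hpr.trans hg
      have hrhs : (1 + ENNReal.ofReal δ) * F (Set.Ioi x) * meanLifetime F B 0 ≠ ∞ := by finiteness
      have hδ1' : (1 - ENNReal.ofReal δ) = ENNReal.ofReal (1 - δ) := by
        rw [ENNReal.ofReal_sub _ hδ0'.le, ENNReal.ofReal_one]
      have hrt : r ≠ ∞ := ne_top_of_le_ne_top hrhs (le_add_self.trans hpr')
      have hpt : p ≠ ∞ := by
        intro h
        have h1 : ENNReal.ofReal (1 - δ) ≠ 0 := by simpa using hδ1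
        rw [h, hδ1', ENNReal.mul_top h1, top_add] at hpr'
        exact hrhs (top_le_iff.1 hpr')
      have hR := ENNReal.toReal_mono hrhs hpr'
      rw [hδ1', ENNReal.toReal_add (by finiteness) hrt, ENNReal.toReal_mul,
        ENNReal.toReal_ofReal (by linarith), ENNReal.toReal_mul, ENNReal.toReal_mul,
        ENNReal.toReal_add (by simp) (by simp), ENNReal.toReal_ofReal hδ0'.le,
        ENNReal.toReal_one] at hR
      have hL := ENNReal.toReal_mono hpt hlow
      rw [ENNReal.toReal_mul, ENNReal.toReal_ofReal (by linarith)] at hL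
      change (e - δ) * F.real (Set.Ioi x) ≤ p.toReal at hL
      change (1 - δ) * p.toReal + r.toReal ≤ (1 + δ) * F.real (Set.Ioi x) * e at hR
      refine hle.trans ?_
      rw [← ENNReal.ofReal_toReal (show p + C * r ≠ ∞ by finiteness)]
      refine ENNReal.ofReal_le_ofReal ?_
      rw [ENNReal.toReal_add hpt (by finiteness), ENNReal.toReal_mul, add_mul]
      refine add_le_add ?_ ?_
      · rw [div_mul_eq_mul_div, le_div_iff₀ (by linarith)]
        nlinarith [ENNReal.toReal_nonneg (a := r)]
      · rw [mul_assoc]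
        refine mul_le_mul_of_nonneg_left ?_ ENNReal.toReal_nonneg
        nlinarith [mul_le_mul_of_nonneg_left hL (by linarith : 0 ≤ 1 - δ)]
    refine iSup_le fun k => ?_
    exact (killedPot_mono 0 (le_max_left k k₀)).trans (hbound _ (le_max_right k k₀))

end Asymptotics

/-! ### From the random walk to killed potentials -/

section Paths

variable {Ω : Type*}

/-- The event that the walk stays in `D` at the times `1, …, n`. -/
def survives (ξ : ℕ → Ω → ℝ) (D : Set ℝ) (n : ℕ) : Set Ω :=
  {ω | ∀ i, 1 ≤ i → i ≤ n → walk ξ i ω ∈ D}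

lemma survives_zero (ξ : ℕ → Ω → ℝ) (D : Set ℝ) : survives ξ D 0 = Set.univ :=
  Set.eq_univ_of_forall fun ω i h1 h2 => by omega

lemma survives_succ (ξ : ℕ → Ω → ℝ) (D : Set ℝ) (n : ℕ) :
    survives ξ D (n + 1) = survives ξ D n ∩ walk ξ (n + 1) ⁻¹' D := by
  ext ω
  refine ⟨fun h => ⟨fun i h1 h2 => h i h1 (by omega), h _ (by omega) le_rfl⟩, fun h i h1 h2 => ?_⟩
  rcases h2.lt_or_eq with h3 | rfl
  · exact h.1 i h1 (by omega)
  · exact h.2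

lemma walk_zero (ξ : ℕ → Ω → ℝ) (ω : Ω) : walk ξ 0 ω = 0 := by simp [walk]

lemma walk_succ (ξ : ℕ → Ω → ℝ) (n : ℕ) (ω : Ω) : walk ξ (n + 1) ω = walk ξ n ω + ξ n ω :=
  Finset.sum_range_succ _ _

lemma exitTime_le_iff (ξ : ℕ → Ω → ℝ) (A : Set ℝ) (ω : Ω) (n : ℕ) :
    exitTime ξ A ω ≤ n ↔ ω ∉ survives ξ Aᶜ n := by
  have h : exitTime ξ A ω ≤ n ↔ ∃ j ∈ Set.Icc 1 n, walk ξ j ω ∈ A := hittingAfter_le_iff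
  rw [h]
  simp only [survives, Set.mem_ofPred_eq, Set.mem_Icc, Set.mem_compl_iff, not_forall, not_not]
  exact ⟨fun ⟨j, h1, h2⟩ => ⟨j, h1.1, h1.2, h2⟩, fun ⟨j, h1, h2, h3⟩ => ⟨j, ⟨h1, h2⟩, h3⟩⟩

lemma lt_exitTime_iff (ξ : ℕ → Ω → ℝ) (A : Set ℝ) (ω : Ω) (n : ℕ) :
    n < exitTime ξ A ω ↔ ω ∈ survives ξ Aᶜ n := by
  rw [← not_le, exitTime_le_iff, not_not]

lemma ENat.toENNReal_eq_tsum (n : ℕ∞) :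
    (n : ℝ≥0∞) = ∑' i : ℕ, if (i : ℕ∞) < n then 1 else 0 := by
  induction n using ENat.recTopCoe with
  | top => simp
  | coe n =>
    rw [tsum_eq_sum (s := Finset.range n)]
    · rw [Finset.sum_congr rfl (g := fun _ => (1 : ℝ≥0∞))]
      · simp
      · intro i hi
        simp [Finset.mem_range.1 hi]
    · intro i hi
      simpa using hi

/-- The first time the walk exceeds `x`, split according to the last time before it. -/
lemma setOf_lt_maxUpToExit (ξ : ℕ → Ω → ℝ) (A : Set ℝ) {x : ℝ} (hx : 0 ≤ x) :
    {ω | (x : EReal) < maxUpToExit ξ A ω} =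
      ⋃ n, survives ξ (Aᶜ ∩ Set.Iic x) n ∩ {ω | x < walk ξ (n + 1) ω} := by
  classical
  ext ω
  simp only [Set.mem_ofPred_eq, maxUpToExit, lt_iSup_iff, EReal.coe_lt_coe_iff, Set.mem_iUnion,
    Set.mem_inter_iff]
  constructor
  · rintro ⟨i, hi, hxi⟩
    have hex : ∃ i, x < walk ξ i ω := ⟨i, hxi⟩
    have hspec := Nat.find_spec hex
    have hle : Nat.find hex ≤ i := Nat.find_min' hex hxi
    obtain ⟨n, hn⟩ : ∃ n, Nat.find hex = n + 1 := by
      refine Nat.exists_eq_succ_of_ne_zero fun h => ?_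
      rw [h, walk_zero] at hspec
      linarith
    rw [hn] at hspec hle
    have hsurv : ω ∈ survives ξ Aᶜ n := by
      rw [← lt_exitTime_iff]
      refine lt_of_lt_of_le ?_ hi
      exact_mod_cast hle
    refine ⟨n, fun j h1 h2 => ⟨hsurv j h1 h2, ?_⟩, hspec⟩
    exact not_lt.1 (Nat.find_min hex (by omega))
  · rintro ⟨n, hsurv, hn⟩
    refine ⟨n + 1, ?_, hn⟩
    have : (n : ℕ∞) < exitTime ξ A ω :=
      (lt_exitTime_iff ξ A ω n).2 fun j h1 h2 => (hsurv j h1 h2).1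
    exact Order.add_one_le_of_lt this

lemma pairwise_disjoint_firstPassage (ξ : ℕ → Ω → ℝ) (B : Set ℝ) (x : ℝ) :
    Pairwise (Function.onFun Disjoint
      fun n => survives ξ (B ∩ Set.Iic x) n ∩ {ω | x < walk ξ (n + 1) ω}) := by
  have key : ∀ m n, m < n → Disjoint
      (survives ξ (B ∩ Set.Iic x) m ∩ {ω | x < walk ξ (m + 1) ω})
      (survives ξ (B ∩ Set.Iic x) n ∩ {ω | x < walk ξ (n + 1) ω}) := fun m n h =>
    Set.disjoint_left.2 fun ω h1 h2 =>
      not_lt.2 (Set.mem_Iic.1 (h2.1 (m + 1) (by omega) h).2) (Set.mem_ofPred.1 h1.2)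
  intro m n hmn
  rcases lt_or_gt_of_ne hmn with h | h
  · exact key m n h
  · exact (key n m h).symm

variable [MeasurableSpace Ω] {P : Measure Ω} [IsProbabilityMeasure P] {F : Measure ℝ}
  [IsProbabilityMeasure F] {ξ : ℕ → Ω → ℝ}

lemma measurable_walk (hξ : ∀ n, Measurable (ξ n)) (n : ℕ) : Measurable (walk ξ n) :=
  Finset.measurable_sum _ fun i _ => hξ i

lemma measurableSet_survives (hξ : ∀ n, Measurable (ξ n)) {D : Set ℝ} (hD : MeasurableSet D)
    (n : ℕ) : MeasurableSet (survives ξ D n) := by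
  induction n with
  | zero =>
    rw [survives_zero]
    exact MeasurableSet.univ
  | succ n ih =>
    rw [survives_succ]
    exact ih.inter (measurable_walk hξ _ hD)

/-- The Markov property at time `n`. -/
lemma setLIntegral_survives_walk_succ (hξ : ∀ n, Measurable (ξ n))
    (hlaw : ∀ n, HasLaw (ξ n) F P) (hindep : iIndepFun ξ P) {D : Set ℝ} (hD : MeasurableSet D)
    {φ : ℝ → ℝ≥0∞} (hφ : Measurable φ) (n : ℕ) :
    ∫⁻ ω in survives ξ D n, φ (walk ξ (n + 1) ω) ∂P =
      ∫⁻ ω in survives ξ D n, ∫⁻ t, φ (walk ξ n ω + t) ∂F ∂P := by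
  -- the past, as a sequence that vanishes from time `n` on
  set ext : ((Finset.range n) → ℝ) → ℕ → ℝ := fun z j =>
    if h : j ∈ Finset.range n then z ⟨j, h⟩ else 0 with hext
  have hextm : Measurable ext := by
    refine measurable_pi_lambda _ fun j => ?_
    by_cases h : j ∈ Finset.range n
    · simp only [hext, h, dite_true]
      exact measurable_pi_apply _
    · simp only [hext, h, dite_false]
      exact measurable_const
  set Z : Ω → ℕ → ℝ := fun ω => ext fun i => ξ i ω with hZ
  have hZm : Measurable Z := hextm.comp (measurable_pi_lambda _ fun i => hξ i)
  have hind : IndepFun Z (ξ n) P :=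
    (hindep.indepFun_finset (Finset.range n) {n} (by simp) hξ).comp hextm
      (measurable_pi_apply (⟨n, by simp⟩ : ({n} : Finset ℕ)))
  set W : ℕ → (ℕ → ℝ) → ℝ := fun i z => ∑ j ∈ Finset.range i, z j with hW
  have hWm : ∀ i, Measurable (W i) := fun i =>
    Finset.measurable_sum _ fun j _ => measurable_pi_apply j
  have hWZ : ∀ i ≤ n, ∀ ω, W i (Z ω) = walk ξ i ω := by
    intro i hi ω
    refine Finset.sum_congr rfl fun j hj => ?_
    have : j ∈ Finset.range n := Finset.mem_range.2 ((Finset.mem_range.1 hj).trans_le hi)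
    simp only [hZ, hext, this, dite_true]
  set E : Set (ℕ → ℝ) := {z | ∀ i, 1 ≤ i → i ≤ n → W i z ∈ D} with hE
  have hEm : MeasurableSet E := by
    simp only [hE, Set.ofPred_forall]
    exact MeasurableSet.iInter fun i => MeasurableSet.iInter fun _ => MeasurableSet.iInter fun _ =>
      hWm i hD
  have hES : survives ξ D n = Z ⁻¹' E := by
    ext ω
    refine forall_congr' fun i => forall_congr' fun _ => forall_congr' fun hi => ?_
    rw [hWZ i hi]
  have hSm := measurableSet_survives hξ hD n
  set Φ : (ℕ → ℝ) × ℝ → ℝ≥0∞ := fun p => E.indicator 1 p.1 * φ (W n p.1 + p.2) with hΦ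
  have hΦm : Measurable Φ := by
    refine ((measurable_one.indicator hEm).comp measurable_fst).mul (hφ.comp ?_)
    exact ((hWm n).comp measurable_fst).add measurable_snd
  have hprod : P.map (fun ω => (Z ω, ξ n ω)) = (P.map Z).prod F := by
    rw [(indepFun_iff_map_prod_eq_prod_map_map hZm.aemeasurable (hξ n).aemeasurable).1 hind,
      (hlaw n).map_eq]
  have hZp : IsProbabilityMeasure (P.map Z) := Measure.isProbabilityMeasure_map hZm.aemeasurable
  calc ∫⁻ ω in survives ξ D n, φ (walk ξ (n + 1) ω) ∂P = ∫⁻ ω, Φ (Z ω, ξ n ω) ∂P := by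
        rw [← lintegral_indicator hSm]
        refine lintegral_congr fun ω => ?_
        simp only [hΦ, hWZ n le_rfl, ← walk_succ]
        by_cases h : ω ∈ survives ξ D n
        · have h' : Z ω ∈ E := by rwa [hES] at h
          simp [h, h']
        · have h' : Z ω ∉ E := by rwa [hES] at h
          simp [h, h']
    _ = ∫⁻ z, ∫⁻ t, Φ (z, t) ∂F ∂(P.map Z) := by
        rw [← lintegral_prod _ hΦm.aemeasurable, ← hprod, lintegral_map hΦm (hZm.prodMk (hξ n))]
    _ = ∫⁻ ω, ∫⁻ t, Φ (Z ω, t) ∂F ∂P := lintegral_map hΦm.lintegral_prod_right' hZm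
    _ = _ := by
        rw [← lintegral_indicator hSm]
        refine lintegral_congr fun ω => ?_
        simp only [hΦ, hWZ n le_rfl]
        by_cases h : ω ∈ survives ξ D n
        · have h' : Z ω ∈ E := by rwa [hES] at h
          simp [h, h']
        · have h' : Z ω ∉ E := by rwa [hES] at h
          simp [h, h']

lemma killedPot_zero_eq_sum (hξ : ∀ n, Measurable (ξ n))
    (hlaw : ∀ n, HasLaw (ξ n) F P) (hindep : iIndepFun ξ P) {D : Set ℝ} (hD : MeasurableSet D)
    {f : ℝ → ℝ≥0∞} (hf : Measurable f) (k : ℕ) :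
    killedPot F D f k 0 = ∑ i ∈ Finset.range k, ∫⁻ ω in survives ξ D i, f (walk ξ i ω) ∂P := by
  have key : ∀ k m, ∫⁻ ω in survives ξ D m, killedPot F D f k (walk ξ m ω) ∂P =
      ∑ i ∈ Finset.range k, ∫⁻ ω in survives ξ D (m + i), f (walk ξ (m + i) ω) ∂P := by
    intro k
    induction k with
    | zero => exact fun m => by simp [killedPot]
    | succ k ih =>
      intro m
      have hpm := measurable_killedPot (F := F) hD hf k
      simp only [killedPot]
      have hfm : Measurable fun ω => f (walk ξ m ω) := hf.comp (measurable_walk hξ m)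
      rw [lintegral_add_left hfm, Finset.sum_range_succ', add_comm,
        add_zero]
      congr 1
      have h1 : ∫⁻ ω in survives ξ D m, killedStep F D (killedPot F D f k) (walk ξ m ω) ∂P =
          ∫⁻ ω in survives ξ D (m + 1), killedPot F D f k (walk ξ (m + 1) ω) ∂P := by
        unfold killedStep
        rw [← setLIntegral_survives_walk_succ hξ hlaw hindep hD (hpm.indicator hD), survives_succ,
          Set.inter_comm, ← Measure.restrict_restrict (measurable_walk hξ _ hD),
          ← lintegral_indicator (measurable_walk hξ _ hD)]
        rfl
      rw [h1, ih]
      refine Finset.sum_congr rfl fun i _ => ?_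
      rw [show m + 1 + i = m + (i + 1) by ring]
  have := key k 0
  simpa [survives_zero, walk_zero] using this

lemma meanExitTime_eq (hξ : ∀ n, Measurable (ξ n)) (hlaw : ∀ n, HasLaw (ξ n) F P)
    (hindep : iIndepFun ξ P) {A : Set ℝ} (hA : MeasurableSet A) :
    meanExitTime P ξ A = meanLifetime F Aᶜ 0 := by
  have h1 : meanExitTime P ξ A = ∑' i, P (survives ξ Aᶜ i) := by
    unfold meanExitTime
    have : ∀ ω, (exitTime ξ A ω : ℝ≥0∞) = ∑' i, (survives ξ Aᶜ i).indicator 1 ω := by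
      intro ω
      rw [ENat.toENNReal_eq_tsum]
      refine tsum_congr fun i => ?_
      by_cases h : ω ∈ survives ξ Aᶜ i
      · rw [if_pos ((lt_exitTime_iff ξ A ω i).2 h), Set.indicator_of_mem h, Pi.one_apply]
      · rw [if_neg (mt (lt_exitTime_iff ξ A ω i).1 h), Set.indicator_of_notMem h]
    rw [lintegral_congr this, lintegral_tsum fun i =>
      (measurable_one.indicator (measurableSet_survives hξ hA.compl i)).aemeasurable]
    exact tsum_congr fun i => lintegral_indicator_one (measurableSet_survives hξ hA.compl i)
  rw [h1, ENNReal.tsum_eq_iSup_nat]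
  refine iSup_congr fun k => ?_
  rw [killedPot_zero_eq_sum hξ hlaw hindep hA.compl measurable_const]
  simp

lemma measure_lt_maxUpToExit (hξ : ∀ n, Measurable (ξ n)) (hlaw : ∀ n, HasLaw (ξ n) F P)
    (hindep : iIndepFun ξ P) {A : Set ℝ} (hA : MeasurableSet A) {x : ℝ} (hx : 0 ≤ x) :
    P {ω | (x : EReal) < maxUpToExit ξ A ω} = ⨆ k, exceedProb F Aᶜ x k 0 := by
  have hDm : MeasurableSet (Aᶜ ∩ Set.Iic x) := hA.compl.inter measurableSet_Iic
  have hgt : ∀ n, MeasurableSet {ω | x < walk ξ n ω} := fun n =>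
    measurableSet_lt measurable_const (measurable_walk hξ n)
  rw [setOf_lt_maxUpToExit ξ A hx, measure_iUnion (pairwise_disjoint_firstPassage ξ _ x) fun n =>
    (measurableSet_survives hξ hDm n).inter (hgt _), ENNReal.tsum_eq_iSup_nat]
  refine iSup_congr fun k => ?_
  rw [exceedProb, killedPot_zero_eq_sum hξ hlaw hindep hDm (measurable_tail_sub x)]
  refine Finset.sum_congr rfl fun n _ => ?_
  have h1 := setLIntegral_survives_walk_succ hξ hlaw hindep hDm
    (φ := (Set.Ioi x).indicator 1) (measurable_one.indicator measurableSet_Ioi) n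
  have h2 : ∀ v, ∫⁻ t, (Set.Ioi x).indicator (1 : ℝ → ℝ≥0∞) (v + t) ∂F = F (Set.Ioi (x - v)) := by
    intro v
    rw [← lintegral_indicator_one measurableSet_Ioi]
    refine lintegral_congr fun t => ?_
    simp only [Set.indicator_apply, Set.mem_Ioi, sub_lt_iff_lt_add']
    rfl
  simp_rw [h2] at h1
  rw [← h1, Set.inter_comm, ← Measure.restrict_apply (hgt _), ← lintegral_indicator_one (hgt _)]
  rfl

end Paths

theorem theorem1 {Ω : Type*} [MeasurableSpace Ω] (P : Measure Ω) [IsProbabilityMeasure P]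
    (F : Measure ℝ) [IsProbabilityMeasure F]
    (ξ : ℕ → Ω → ℝ) (hlaw : ∀ n, HasLaw (ξ n) F P) (hindep : iIndepFun ξ P)
    (hneg : negPartMean F = ∞) (hK : tailConst F < ∞)
    (G₁ : Measure ℝ) (hG₁ : IsWeightedTailLaw F G₁) (hS : InClassS F G₁) :
    ∀ A ∈ ({Set.Iio 0, Set.Iic 0} : Set (Set ℝ)),
      meanExitTime P ξ A < ∞ ∧
      Tendsto (fun x : ℝ =>
        P.real {ω | (x : EReal) < maxUpToExit ξ A ω} /
          ((meanExitTime P ξ A).toReal * F.real (Set.Ioi x))) atTop (𝓝 1) := by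
  intro A hA
  obtain ⟨hAm, hup, hpos, h0⟩ : MeasurableSet A ∧ IsUpperSet Aᶜ ∧ Set.Ioi 0 ⊆ Aᶜ ∧
      Aᶜ ⊆ Set.Ici 0 := by
    rcases hA with rfl | rfl
    · rw [Set.compl_Iio]
      exact ⟨measurableSet_Iio, isUpperSet_Ici 0, Set.Ioi_subset_Ici_self, le_rfl⟩
    · rw [Set.compl_Iic]
      exact ⟨measurableSet_Iic, isUpperSet_Ioi 0, le_rfl, Set.Ioi_subset_Ici_self⟩
  -- the steps are only almost everywhere measurable: pass to measurable versions
  set η : ℕ → Ω → ℝ := fun n => (hlaw n).aemeasurable.mk (ξ n) with hη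
  have hηm : ∀ n, Measurable (η n) := fun n => (hlaw n).aemeasurable.measurable_mk
  have hξη : ∀ n, ξ n =ᵐ[P] η n := fun n => (hlaw n).aemeasurable.ae_eq_mk
  have hηlaw : ∀ n, HasLaw (η n) F P := fun n =>
    ⟨(hηm n).aemeasurable, by rw [← Measure.map_congr (hξη n), (hlaw n).map_eq]⟩
  have hηindep : iIndepFun η P := hindep.congr hξη
  have hwalk : ∀ᵐ ω ∂P, ∀ n, walk ξ n ω = walk η n ω := by
    filter_upwards [ae_all_iff.2 hξη] with ω hω n
    exact Finset.sum_congr rfl fun i _ => hω i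
  have hexit : ∀ᵐ ω ∂P, exitTime ξ A ω = exitTime η A ω := by
    filter_upwards [hwalk] with ω hω
    refine eq_of_forall_ge_iff fun n => ?_
    induction n using ENat.recTopCoe with
    | top => simp
    | coe n =>
      rw [exitTime_le_iff, exitTime_le_iff]
      simp only [survives, Set.mem_ofPred_eq, hω]
  have hmean : meanExitTime P ξ A = meanLifetime F Aᶜ 0 := by
    rw [← meanExitTime_eq hηm hηlaw hηindep hAm]
    refine lintegral_congr_ae ?_
    filter_upwards [hexit] with ω hω
    rw [hω]
  have hmax : ∀ x : ℝ, 0 ≤ x → P {ω | (x : EReal) < maxUpToExit ξ A ω} =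
      ⨆ k, exceedProb F Aᶜ x k 0 := by
    intro x hx
    rw [← measure_lt_maxUpToExit hηm hηlaw hηindep hAm hx]
    refine measure_congr ?_
    filter_upwards [hexit, hwalk] with ω h1 h2
    have : maxUpToExit ξ A ω = maxUpToExit η A ω := by simp only [maxUpToExit, h1, h2]
    exact congrArg (fun m : EReal => (x : EReal) < m) this
  have hfin := meanLifetime_ne_top hneg hK h0 le_rfl
  rw [hmean]
  refine ⟨hfin.lt_top, ?_⟩
  have he : (meanLifetime F Aᶜ 0).toReal ≠ 0 :=
    (ENNReal.toReal_pos (zero_lt_one.trans_le (one_le_meanLifetime hAm.compl 0)).ne' hfin).ne'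
  have hlim := (tendsto_exceedProb hneg hK hG₁ hS hup hAm.compl hpos h0).div_const
    (meanLifetime F Aᶜ 0).toReal
  rw [div_self he] at hlim
  refine hlim.congr' ?_
  filter_upwards [eventually_ge_atTop 0] with x hx
  rw [measureReal_def P, hmax x hx, div_div, mul_comm (F.real _)]
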